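/- Let $n\ge 2$. A bounded domain is a nonempty, bounded, connected, open subset of $\mathbb R^n$. A Lipschitz domain is a bounded domain $U$ such that, near every point of $\partial U$ and after a rotation of the axes, $U$ is the set of points lying strictly above the graph of a Lipschitz function of the first $n-1$ coordinates. A John domain is a bounded domain $U$ for which there are $x_0\in U$ and $\alpha>0$ such that every $x\in U$ can be joined to $x_0$ by a rectifiable path $\gamma:[0,L]\to U$, parametrized by arclength, with $\gamma(0)=x$, $\gamma(L)=x_0$ and $B(\gamma(t),t/\alpha)\subset U$ for all $t\in[0,L]$. For a measurable set $V$ with $0<|V|<\infty$ write $\langle\psi\rangle_V=\frac1{|V|}\int_V\psi\,dx$. Put $$|||\psi|||_{\mathrm{BMO}(U)}=\sup_{Q\subset U}\frac1{|Q|}\int_Q|\psi-\langle\psi\rangle_Q|\,dx,$$ the supremum being over all nonempty bounded open cubes $Q\subset U$ with faces parallel to the coordinate hyperplanes; $\mathrm{BMO}(U)$ is the set of real-valued $\psi\in L^1_{\mathrm{loc}}(U)$ for which this is finite. For $\psi\in \mathrm{BMO}(U)\cap L^1(U)$ let $$\|\psi\|_{\mathrm{BMO}(U)\cap L^1(U)}=|||\psi|||_{\mathrm{BMO}(U)}+|\langle\psi\rangle_U|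 ,\qquad \|\psi\|_{p,U}=\Big(\int_U|\psi|^p\,dx\Big)^{1/p}.$$ **Theorem.** Let $U\subset\mathbb R^n$ be a Lipschitz domain or a John domain. (i) For every $q\in[1,\infty)$, $\mathrm{BMO}(U)\cap L^1(U)\subset L^q(U)$ with continuous injection: there is a constant $J_1=J_1(q,U)>0$ such that every $\psi\in\mathrm{BMO}(U)\cap L^1(U)$ satisfies $$\Big(\frac1{|U|}\int_U|\psi|^q\,dx\Big)^{1/q}\le J_1\,\|\psi\|_{\mathrm{BMO}(U)\cap L^1(U)} .$$ (ii) If $1\le p<q<\infty$, there is a constant $J_2=J_2(p,q,U)>0$ such that every $\psi\in\mathrm{BMO}(U)\cap L^1(U)$ satisfies $$\|\psi\|_{q,U}\le J_2\,\big(\|\psi\|_{\mathrm{BMO}(U)\cap L^1(U)}\big)^{1-p/q}\,\big(\|\psi\|_{p,U}\big)^{p/q}.$$ (iii) These constants can be chosen, for all Lipschitz and John domains $U$ simultaneously, to be invariant under scaling and translation: $J_1(q,\lambda U+a)=J_1(q,U)$ and $J_2(p,q,\lambda U+a)=J_2(p,q,U)$ for every $\lambda>0$ and $a\in\mathbb R^n$.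 -/

import Mathlib

open MeasureTheory
open scoped ENNReal NNReal

noncomputable section

namespace BMOInterp

/-- A bounded domain of `ℝⁿ`: a nonempty, connected, open and bounded set. -/
def IsBoundedDomain {n : ℕ} (U : Set (EuclideanSpace ℝ (Fin n))) : Prop :=
  IsOpen U ∧ IsConnected U ∧ Bornology.IsBounded U

/-- A (strongly) Lipschitz domain: a bounded domain `U` such that near every boundary point `x`,
after a rotation of the axes, `U` is the set of points that lie strictly above the graph of a
Lipschitz function. Here the unit vector `ν` is the direction of the rotated last axis, `⟪ν, y⟫` is
the last coordinate of `y`, and the orthogonal projection of `y` onto the hyperplane `ν^⊥` stands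
for the other `n - 1` coordinates. -/
def IsLipschitzDomain {n : ℕ} (U : Set (EuclideanSpace ℝ (Fin n))) : Prop :=
  IsBoundedDomain U ∧
    ∀ x ∈ frontier U, ∃ r : ℝ, 0 < r ∧ ∃ ν : EuclideanSpace ℝ (Fin n), ‖ν‖ = 1 ∧
      ∃ (K : ℝ≥0) (γ : (Submodule.span ℝ {ν})ᗮ → ℝ), LipschitzWith K γ ∧
        ∀ y ∈ Metric.ball x r,
          (y ∈ U ↔ γ ((Submodule.span ℝ {ν})ᗮ.orthogonalProjectionOnto y) < inner ℝ ν y)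

/-- A John domain: a bounded domain `U` with a centre `x₀ ∈ U` and a constant `α > 0` such that
every `x ∈ U` is joined to `x₀` by a rectifiable path `γ : [0, L] → U`, parametrized by arclength,
with `B(γ t, t / α) ⊆ U` for all `t ∈ [0, L]`. -/
def IsJohnDomain {n : ℕ} (U : Set (EuclideanSpace ℝ (Fin n))) : Prop :=
  IsBoundedDomain U ∧
    ∃ x₀ ∈ U, ∃ α : ℝ, 0 < α ∧ ∀ x ∈ U, ∃ (L : ℝ) (γ : ℝ → EuclideanSpace ℝ (Fin n)),
      0 ≤ L ∧ HasUnitSpeedOn γ (Set.Icc 0 L) ∧ γ 0 = x ∧ γ L = x₀ ∧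
        ∀ t ∈ Set.Icc 0 L, γ t ∈ U ∧ Metric.ball (γ t) (t / α) ⊆ U

/-- The open cube with faces parallel to the coordinate hyperplanes, centre `c` and side `2r`. -/
def cube {n : ℕ} (c : EuclideanSpace ℝ (Fin n)) (r : ℝ) : Set (EuclideanSpace ℝ (Fin n)) :=
  {x | ∀ i, |x i - c i| < r}

/-- The BMO seminorm of `ψ` on `V`, with values in `[0, ∞]`: the supremum over all cubes `Q ⊆ V` of
the mean over `Q` of `|ψ - ⟨ψ⟩_Q|`. -/
def bmoSeminorm {n : ℕ} (V : Set (EuclideanSpace ℝ (Fin n)))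
    (ψ : EuclideanSpace ℝ (Fin n) → ℝ) : ℝ≥0∞ :=
  ⨆ (c : EuclideanSpace ℝ (Fin n)) (r : ℝ) (_ : 0 < r) (_ : cube c r ⊆ V),
    ⨍⁻ x in cube c r, ‖ψ x - ⨍ y in cube c r, ψ y‖ₑ ∂volume

/-- `ψ ∈ BMO(V)`. -/
def MemBMO {n : ℕ} (V : Set (EuclideanSpace ℝ (Fin n)))
    (ψ : EuclideanSpace ℝ (Fin n) → ℝ) : Prop :=
  LocallyIntegrableOn ψ V ∧ bmoSeminorm V ψ < ∞

/-- `ψ ∈ BMO(V) ∩ L¹(V)`. -/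
def MemBMOL1 {n : ℕ} (V : Set (EuclideanSpace ℝ (Fin n)))
    (ψ : EuclideanSpace ℝ (Fin n) → ℝ) : Prop :=
  MemBMO V ψ ∧ IntegrableOn ψ V

/-- The norm on `BMO(V) ∩ L¹(V)`: the BMO seminorm plus the modulus of the mean over `V`. -/
def bmoL1Norm {n : ℕ} (V : Set (EuclideanSpace ℝ (Fin n)))
    (ψ : EuclideanSpace ℝ (Fin n) → ℝ) : ℝ :=
  (bmoSeminorm V ψ).toReal + |⨍ x in V, ψ x|

/-- The norm `‖ψ‖_{p,V} = (∫_V |ψ|^p)^{1/p}` of a function `ψ ∈ L^p(V)`, `1 ≤ p < ∞`. -/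
def normLp {n : ℕ} (p : ℝ) (V : Set (EuclideanSpace ℝ (Fin n)))
    (ψ : EuclideanSpace ℝ (Fin n) → ℝ) : ℝ :=
  (∫ x in V, |ψ x| ^ p) ^ (1 / p)

end BMOInterp

end

/-! On a single cube the inequalities are John–Nirenberg theory. The difficulty is to pass to a
domain whose points may be reached from its centre only through long chains of Whitney cubes. By
homogeneity the mean oscillation over every cube in `U` and `|⟨ψ⟩_U|` may be taken at most 1. The
work is done in the sup norm, where cubes are balls.

The geometry enters only through `ChainCondition`. A John path is discretised; in a Lipschitz domain
one moves inwards along the axis of a local graph and continues by an interior chain, with constants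
uniform by compactness. In terms of Whitney cubes, means over consecutive cubes of a chain differ by
a bounded amount, and a fixed multiple of each cube of the chain contains all earlier ones. Hence
`|ψ_Q - ψ_{Q₀}| ≤ C N(Q)`, where `N(Q)` counts the cubes near `Q₀` with a fixed multiple containing
`Q`. The moments `∑ N(Q)^m |Q|` are bounded by `sum_mul_card_pow_le`, which needs only a packing
property. Together with the John–Nirenberg inequality on each cube this gives (i).

For (ii), call a Whitney cube bad if the mean of `|ψ|^p` over it exceeds 1. On a good cube, a
Calderón–Zygmund decomposition of `|ψ|^p` at level 1 bounds `∫|ψ|^q` by `∫|ψ|^p`. From a bad cube,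
follow the chain to the last bad cube `P` before a good one. The mean over `P` is bounded, so the
bad cubes stopped at `P` contribute at most a multiple of `|P|`, which is less than `∫_P |ψ|^p`; now
sum over the distinct `P`. If the central cube is bad, `∫_U |ψ|^p` is bounded below and (i)
suffices.

For (iii), a domain and its scaled translates have the same set of admissible constants, so a choice
that depends only on this set is invariant. -/

namespace BMOInterp

/-! ### Dyadic cubes -/

/-- Indices of dyadic cubes: a generation and the integer coordinates of the lower corner. -/
abbrev DyadicIndex (n : ℕ) : Type := ℕ × (Fin n → ℤ)

/-- The side of the dyadic cubes of generation `k`, where those of generation `0` have side `s`. -/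
noncomputable def dyadicSide (s : ℝ) (k : ℕ) : ℝ := s / 2 ^ k

/-- The coordinates of the dyadic cube of generation `k` that contains `x`. -/
noncomputable def dyadicCoord {n : ℕ} (s : ℝ) (k : ℕ) (x : Fin n → ℝ) : Fin n → ℤ :=
  fun i => ⌊x i / dyadicSide s k⌋

/-- The half-open dyadic cube with index `c`. -/
def dyadicCube {n : ℕ} (s : ℝ) (c : DyadicIndex n) : Set (Fin n → ℝ) :=
  {x | dyadicCoord s c.1 x = c.2}

/-- The centre of the dyadic cube with index `c`. -/
noncomputable def dyadicCenter {n : ℕ} (s : ℝ) (c : DyadicIndex n) : Fin n → ℝ :=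
  fun i => (c.2 i + 1 / 2) * dyadicSide s c.1

section Dyadic

variable {n : ℕ} {s : ℝ}

lemma dyadicSide_pos (hs : 0 < s) (k : ℕ) : 0 < dyadicSide s k := by
  unfold dyadicSide; positivity

lemma dyadicSide_succ (s : ℝ) (k : ℕ) : dyadicSide s k = 2 * dyadicSide s (k + 1) := by
  unfold dyadicSide; rw [pow_succ]; field_simp

lemma tendsto_dyadicSide (s : ℝ) :
    Filter.Tendsto (dyadicSide s) Filter.atTop (nhds 0) := by
  have h := (tendsto_pow_atTop_nhds_zero_of_lt_one (r := (1 / 2 : ℝ)) (by norm_num)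
    (by norm_num)).const_mul s
  rw [mul_zero] at h
  refine h.congr fun k => ?_
  simp [dyadicSide, div_eq_mul_inv]

lemma mem_dyadicCube_iff (hs : 0 < s) {c : DyadicIndex n} {x : Fin n → ℝ} :
    x ∈ dyadicCube s c ↔
      ∀ i, (c.2 i : ℝ) * dyadicSide s c.1 ≤ x i ∧ x i < (c.2 i + 1) * dyadicSide s c.1 := by
  have hl := dyadicSide_pos hs c.1
  simp only [dyadicCube, Set.mem_ofPred_eq, funext_iff, dyadicCoord, Int.floor_eq_iff]
  refine forall_congr' fun i => ?_
  rw [le_div_iff₀ hl, div_lt_iff₀ hl]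

lemma mem_dyadicCube_self (s : ℝ) (k : ℕ) (x : Fin n → ℝ) :
    x ∈ dyadicCube s (k, dyadicCoord s k x) := rfl

lemma ball_subset_dyadicCube (hs : 0 < s) (c : DyadicIndex n) :
    Metric.ball (dyadicCenter s c) (dyadicSide s c.1 / 2) ⊆ dyadicCube s c := by
  have hl := dyadicSide_pos hs c.1
  intro x hx
  rw [mem_dyadicCube_iff hs]
  intro i
  rw [Metric.mem_ball, dist_pi_lt_iff (by positivity)] at hx
  have h := abs_lt.1 (Real.dist_eq (x i) _ ▸ hx i)
  simp only [dyadicCenter] at h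
  constructor <;> nlinarith

lemma dyadicCube_subset_closedBall (hs : 0 < s) (c : DyadicIndex n) :
    dyadicCube s c ⊆ Metric.closedBall (dyadicCenter s c) (dyadicSide s c.1 / 2) := by
  have hl := dyadicSide_pos hs c.1
  intro x hx
  rw [mem_dyadicCube_iff hs] at hx
  rw [Metric.mem_closedBall, dist_pi_le_iff (by positivity)]
  intro i
  rw [Real.dist_eq, abs_le]
  have := hx i
  simp only [dyadicCenter]
  constructor <;> nlinarith

lemma dyadicCenter_mem (hs : 0 < s) (c : DyadicIndex n) :
    dyadicCenter s c ∈ dyadicCube s c :=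
  ball_subset_dyadicCube hs c (Metric.mem_ball_self (half_pos (dyadicSide_pos hs _)))

lemma measurableSet_dyadicCube (hs : 0 < s) (c : DyadicIndex n) :
    MeasurableSet (dyadicCube s c) := by
  have : dyadicCube s c = Set.pi Set.univ fun i =>
      Set.Ico ((c.2 i : ℝ) * dyadicSide s c.1) ((c.2 i + 1) * dyadicSide s c.1) := by
    ext x
    simp [mem_dyadicCube_iff hs]
  rw [this]
  exact MeasurableSet.univ_pi fun i => measurableSet_Ico

lemma volume_dyadicCube (hs : 0 < s) (c : DyadicIndex n) :
    volume (dyadicCube s c) = ENNReal.ofReal (dyadicSide s c.1 ^ n) := by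
  have : dyadicCube s c = Set.pi Set.univ fun i =>
      Set.Ico ((c.2 i : ℝ) * dyadicSide s c.1) ((c.2 i + 1) * dyadicSide s c.1) := by
    ext x
    simp [mem_dyadicCube_iff hs]
  rw [this, volume_pi_pi]
  simp only [Real.volume_Ico]
  rw [ENNReal.ofReal_pow (dyadicSide_pos hs _).le]
  have h : ∀ i : Fin n, ((c.2 i : ℝ) + 1) * dyadicSide s c.1 - c.2 i * dyadicSide s c.1
      = dyadicSide s c.1 := fun i => by ring
  simp [h]

lemma volume_dyadicCube_ne_top (hs : 0 < s) (c : DyadicIndex n) :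
    volume (dyadicCube s c) ≠ ∞ := by
  rw [volume_dyadicCube hs]; exact ENNReal.ofReal_ne_top

lemma volume_dyadicCube_ne_zero (hs : 0 < s) (c : DyadicIndex n) :
    volume (dyadicCube s c) ≠ 0 := by
  rw [volume_dyadicCube hs]
  simpa using pow_pos (dyadicSide_pos hs c.1) n

lemma volume_dyadicCube_succ (hs : 0 < s) (k : ℕ) (z z' : Fin n → ℤ) :
    volume (dyadicCube s (k, z)) = 2 ^ n * volume (dyadicCube s (k + 1, z')) := by
  rw [volume_dyadicCube hs, volume_dyadicCube hs]
  simp only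
  rw [dyadicSide_succ s k, mul_pow, ENNReal.ofReal_mul (by positivity),
    ENNReal.ofReal_pow (by norm_num)]
  simp

/-- Half-open cubes partition exactly, while the oscillation hypothesis speaks of open balls; the
difference is a null set. -/
lemma dyadicCube_ae_eq_ball (hs : 0 < s) (c : DyadicIndex n) :
    dyadicCube s c =ᵐ[volume]
      Metric.ball (dyadicCenter s c) (dyadicSide s c.1 / 2) := by
  have hl := dyadicSide_pos hs c.1
  refine (ae_eq_of_subset_of_measure_ge (ball_subset_dyadicCube hs c) ?_
    measurableSet_ball.nullMeasurableSet (volume_dyadicCube_ne_top hs c)).symm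
  rw [volume_dyadicCube hs, Real.volume_pi_ball _ (by positivity), Fintype.card_fin]
  apply le_of_eq; congr 2; ring

lemma dyadicCube_ae_eq_closedBall (hs : 0 < s) (c : DyadicIndex n) :
    dyadicCube s c =ᵐ[volume]
      Metric.closedBall (dyadicCenter s c) (dyadicSide s c.1 / 2) := by
  have hl := dyadicSide_pos hs c.1
  refine ae_eq_of_subset_of_measure_ge (dyadicCube_subset_closedBall hs c) ?_
    (measurableSet_dyadicCube hs c).nullMeasurableSet measure_closedBall_lt_top.ne
  rw [volume_dyadicCube hs, Real.volume_pi_closedBall _ (by positivity), Fintype.card_fin]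
  apply le_of_eq; congr 2; ring

/-- The source of nesting: `⌊x / m⌋ = ⌊x⌋ / m` for natural `m`, so coarse coordinates are integer
quotients of fine ones. -/
lemma dyadicCoord_of_le (s : ℝ) {j k : ℕ} (hjk : j ≤ k) (x : Fin n → ℝ) :
    dyadicCoord s j x = fun i => dyadicCoord s k x i / ((2 ^ (k - j) : ℕ) : ℤ) := by
  funext i
  simp only [dyadicCoord]
  rw [← Int.floor_div_natCast]
  congr 1
  unfold dyadicSide
  obtain ⟨m, rfl⟩ := Nat.exists_eq_add_of_le hjk
  simp only [add_tsub_cancel_left, pow_add]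
  push_cast
  field_simp

lemma dyadicCube_subset_of_mem {j k : ℕ} (hjk : j ≤ k) {z z' : Fin n → ℤ} {x : Fin n → ℝ}
    (hx : x ∈ dyadicCube s (j, z)) (hx' : x ∈ dyadicCube s (k, z')) :
    dyadicCube s (k, z') ⊆ dyadicCube s (j, z) := by
  intro y hy
  simp only [dyadicCube, Set.mem_ofPred_eq] at *
  rw [← hx, dyadicCoord_of_le s hjk, dyadicCoord_of_le s hjk, hx', hy]

/-- The maximal ones among the dyadic cubes that satisfy `S`. -/
def maximalDyadic (s : ℝ) (S : Set (DyadicIndex n)) : Set (DyadicIndex n) :=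
  {c | c ∈ S ∧ ∀ j < c.1, ∀ z, dyadicCube s c ⊆ dyadicCube s (j, z) → (j, z) ∉ S}

lemma eq_of_mem_maximalDyadic {S : Set (DyadicIndex n)} {c c' : DyadicIndex n}
    (hc : c ∈ maximalDyadic s S) (hc' : c' ∈ maximalDyadic s S) {x : Fin n → ℝ}
    (hx : x ∈ dyadicCube s c) (hx' : x ∈ dyadicCube s c') : c = c' := by
  obtain ⟨k, z⟩ := c
  obtain ⟨k', z'⟩ := c'
  rcases lt_trichotomy k k' with h | h | h
  · exact absurd hc.1 (hc'.2 k h z (dyadicCube_subset_of_mem h.le hx hx'))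
  · subst h
    simp only [dyadicCube, Set.mem_ofPred_eq] at hx hx'
    rw [← hx, ← hx']
  · exact absurd hc'.1 (hc.2 k' h z' (dyadicCube_subset_of_mem h.le hx' hx))

lemma disjoint_of_mem_maximalDyadic {S : Set (DyadicIndex n)} :
    (maximalDyadic s S).PairwiseDisjoint (dyadicCube s) := by
  intro c hc c' hc' hne
  rw [Function.onFun, Set.disjoint_left]
  exact fun x hx hx' => hne (eq_of_mem_maximalDyadic hc hc' hx hx')

lemma exists_mem_maximalDyadic {S : Set (DyadicIndex n)} {x : Fin n → ℝ} {c : DyadicIndex n}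
    (hc : c ∈ S) (hx : x ∈ dyadicCube s c) :
    ∃ c' ∈ maximalDyadic s S, x ∈ dyadicCube s c' := by
  classical
  have h : ∃ k, (k, dyadicCoord s k x) ∈ S := ⟨c.1, by
    simp only [dyadicCube, Set.mem_ofPred_eq] at hx
    rwa [hx]⟩
  refine ⟨(Nat.find h, dyadicCoord s (Nat.find h) x), ⟨Nat.find_spec h, fun j hj z hz hS => ?_⟩,
    mem_dyadicCube_self s _ x⟩
  have : dyadicCoord s j x = z := hz (mem_dyadicCube_self s _ x)
  exact Nat.find_min h hj (this ▸ hS)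

end Dyadic

/-! ### The Calderón–Zygmund decomposition -/

section CalderonZygmund

variable {n : ℕ} {s : ℝ}

/-- The point `x` is not the centre of its dyadic cubes but lies within one radius of it, which the
Vitali family of a doubling measure allows. -/
lemma ae_tendsto_dyadic_average (hs : 0 < s) {g : (Fin n → ℝ) → ℝ≥0∞} (hg : AEMeasurable g)
    (hfin : ∫⁻ x, g x ≠ ∞) :
    ∀ᵐ x, Filter.Tendsto (fun k : ℕ => (∫⁻ y in dyadicCube s (k, dyadicCoord s k x), g y) /
      volume (dyadicCube s (k, dyadicCoord s k x))) Filter.atTop (nhds (g x)) := by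
  filter_upwards [VitaliFamily.ae_tendsto_lintegral_div
    (IsUnifLocDoublingMeasure.vitaliFamily (volume : Measure (Fin n → ℝ)) 1) hg hfin] with x hx
  have h1 := IsUnifLocDoublingMeasure.tendsto_closedBall_filterAt
    (volume : Measure (Fin n → ℝ)) (K := 1) (x := x) (l := Filter.atTop)
    (fun k : ℕ => dyadicCenter s (k, dyadicCoord s k x)) (fun k => dyadicSide s k / 2)
    (by
      rw [tendsto_nhdsWithin_iff]
      refine ⟨by simpa using (tendsto_dyadicSide s).div_const 2, ?_⟩
      exact Filter.Eventually.of_forall fun k => half_pos (dyadicSide_pos hs k))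
    (Filter.Eventually.of_forall fun k => by
      rw [one_mul]
      exact dyadicCube_subset_closedBall hs _ (mem_dyadicCube_self s k x))
  refine (hx.comp h1).congr fun k => ?_
  have h2 := dyadicCube_ae_eq_closedBall hs (k, dyadicCoord s k x)
  simp only [Function.comp]
  rw [measure_congr h2, setLIntegral_congr h2]

/-- The family consists of the maximal subcubes of mean above `a`. The upper bound holds because the
parent was not selected and has `2 ^ n` times the volume. Off the family all small dyadic means are
at most `a`, and differentiation passes this on to `g`. -/
theorem exists_calderonZygmund (hs : 0 < s) (c₀ : DyadicIndex n) {g : (Fin n → ℝ) → ℝ≥0∞}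
    (hg : AEMeasurable g (volume.restrict (dyadicCube s c₀)))
    (hfin : ∫⁻ x in dyadicCube s c₀, g x ≠ ∞) {a : ℝ≥0∞}
    (ha : ∫⁻ x in dyadicCube s c₀, g x ≤ a * volume (dyadicCube s c₀)) :
    ∃ T : Set (DyadicIndex n), T.PairwiseDisjoint (dyadicCube s) ∧
      (∀ c ∈ T, dyadicCube s c ⊆ dyadicCube s c₀ ∧
        a * volume (dyadicCube s c) < ∫⁻ x in dyadicCube s c, g x ∧
        ∫⁻ x in dyadicCube s c, g x ≤ 2 ^ n * a * volume (dyadicCube s c)) ∧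
      ∀ᵐ x ∂(volume.restrict (dyadicCube s c₀)), (∀ c ∈ T, x ∉ dyadicCube s c) → g x ≤ a := by
  set S : Set (DyadicIndex n) := {c | c₀.1 ≤ c.1 ∧ dyadicCube s c ⊆ dyadicCube s c₀ ∧
    a * volume (dyadicCube s c) < ∫⁻ x in dyadicCube s c, g x} with hS
  have hm := measurableSet_dyadicCube hs c₀
  refine ⟨maximalDyadic s S, disjoint_of_mem_maximalDyadic, ?_, ?_⟩
  · rintro ⟨k, z⟩ hc
    obtain ⟨⟨hk, hsub, hlt⟩, hmax⟩ := hc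
    refine ⟨hsub, hlt, ?_⟩
    simp only at hk
    have hmem := dyadicCenter_mem hs (k, z)
    rcases hk.eq_or_lt with h | h
    -- The top cube is excluded by `ha`; hence each selected cube has a parent inside it.
    · exfalso
      have : (k, z) = c₀ := by
        have h1 := hsub hmem
        simp only [dyadicCube, Set.mem_ofPred_eq] at h1 hmem
        exact Prod.ext h.symm (by rw [← h1, h, hmem])
      rw [this] at hlt
      exact absurd hlt ha.not_gt
    · obtain ⟨j, rfl⟩ : ∃ j, k = j + 1 := ⟨k - 1, by omega⟩
      have hmem' := mem_dyadicCube_self s j (dyadicCenter s (j + 1, z))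
      have hpar := dyadicCube_subset_of_mem (Nat.le_succ j) hmem' hmem
      have hpar' : dyadicCube s (j, dyadicCoord s j (dyadicCenter s (j + 1, z))) ⊆
          dyadicCube s c₀ :=
        dyadicCube_subset_of_mem (j := c₀.1) (z := c₀.2) (by omega) (hsub hmem) hmem'
      have hnot := hmax j (Nat.lt_succ_self j) _ hpar
      have hle : ∫⁻ x in dyadicCube s (j, dyadicCoord s j (dyadicCenter s (j + 1, z))), g x ≤
          a * volume (dyadicCube s (j, dyadicCoord s j (dyadicCenter s (j + 1, z)))) := by
        by_contra hcon
        exact hnot ⟨by simp only; omega, hpar', not_le.1 hcon⟩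
      calc ∫⁻ x in dyadicCube s (j + 1, z), g x ≤ _ := lintegral_mono_set hpar
        _ ≤ _ := hle
        _ = _ := by rw [volume_dyadicCube_succ hs j _ z]; ring
  · rw [ae_restrict_iff' hm]
    have hfin' : ∫⁻ x, (dyadicCube s c₀).indicator g x ≠ ∞ := by
      rwa [lintegral_indicator hm]
    filter_upwards [ae_tendsto_dyadic_average hs ((aemeasurable_indicator_iff hm).2 hg) hfin']
      with x hx hxc hT
    rw [Set.indicator_of_mem hxc] at hx
    refine le_of_tendsto hx (Filter.eventually_atTop.2 ⟨c₀.1, fun k hk => ?_⟩)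
    have hsub : dyadicCube s (k, dyadicCoord s k x) ⊆ dyadicCube s c₀ :=
      dyadicCube_subset_of_mem (j := c₀.1) (z := c₀.2) hk hxc (mem_dyadicCube_self s k x)
    refine ENNReal.div_le_of_le_mul ?_
    rw [setLIntegral_indicator hm, Set.inter_eq_self_of_subset_right hsub]
    by_contra hcon
    obtain ⟨c', hc', hxc'⟩ := exists_mem_maximalDyadic (S := S)
      (c := (k, dyadicCoord s k x)) ⟨hk, hsub, not_le.1 hcon⟩ (mem_dyadicCube_self s k x)
    exact hT c' hc' hxc'

end CalderonZygmund

/-! ### The John–Nirenberg inequality -/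

/-- The mean oscillation of `ψ` over every ball (for the sup norm) in `U` is at most `1`. -/
def OscLEOne {n : ℕ} (U : Set (Fin n → ℝ)) (ψ : (Fin n → ℝ) → ℝ) : Prop :=
  ∀ c r, 0 < r → Metric.ball c r ⊆ U →
    ∫⁻ x in Metric.ball c r, ‖ψ x - ⨍ y in Metric.ball c r, ψ y‖ₑ ≤ volume (Metric.ball c r)

/-- The mean of `ψ` over a dyadic cube. -/
noncomputable def dyadicMean {n : ℕ} (s : ℝ) (ψ : (Fin n → ℝ) → ℝ) (c : DyadicIndex n) : ℝ :=
  ⨍ x in dyadicCube s c, ψ x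

lemma abs_average_sub_le {α : Type*} [MeasurableSpace α] {μ : Measure α} {E : Set α}
    (h0 : μ E ≠ 0) (htop : μ E ≠ ∞) {ψ : α → ℝ} (hψ : IntegrableOn ψ E μ) {a K : ℝ}
    (hK : 0 ≤ K) (h : ∫⁻ x in E, ‖ψ x - a‖ₑ ∂μ ≤ ENNReal.ofReal K * μ E) :
    |(⨍ x in E, ψ x ∂μ) - a| ≤ K := by
  have hpos : 0 < μ.real E := ENNReal.toReal_pos h0 htop
  have hint : IntegrableOn (fun x => ψ x - a) E μ := hψ.sub (integrableOn_const htop)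
  have h1 : (⨍ x in E, ψ x ∂μ) - a = (μ.real E)⁻¹ * ∫ x in E, (ψ x - a) ∂μ := by
    rw [integral_sub hψ (integrableOn_const htop), setAverage_eq, setIntegral_const]
    simp only [smul_eq_mul]
    field_simp
  have h2 : |∫ x in E, (ψ x - a) ∂μ| ≤ K * μ.real E := by
    have h3 : ENNReal.ofReal |∫ x in E, (ψ x - a) ∂μ| ≤ ENNReal.ofReal (K * μ.real E) := by
      rw [← Real.enorm_eq_ofReal_abs]
      refine (enorm_integral_le_lintegral_enorm _).trans (h.trans (le_of_eq ?_))
      rw [ENNReal.ofReal_mul hK, measureReal_def, ENNReal.ofReal_toReal htop]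
    exact (ENNReal.ofReal_le_ofReal_iff (by positivity)).1 h3
  rw [h1, abs_mul, abs_of_pos (inv_pos.2 hpos), inv_mul_le_iff₀ hpos]
  linarith

lemma add_pow_le_two_pow_mul (a b : ℝ≥0∞) (m : ℕ) : (a + b) ^ m ≤ 2 ^ m * (a ^ m + b ^ m) := by
  have h : a + b ≤ 2 * max a b := by
    rw [two_mul]; exact add_le_add (le_max_left _ _) (le_max_right _ _)
  refine (pow_le_pow_left' h m).trans ?_
  rw [mul_pow]
  gcongr
  rcases le_total a b with hab | hab
  · rw [max_eq_right hab]; exact le_add_self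
  · rw [max_eq_left hab]; exact le_self_add

section JohnNirenberg

variable {n : ℕ} {s : ℝ} {U : Set (Fin n → ℝ)} {ψ : (Fin n → ℝ) → ℝ}

lemma OscLEOne.dyadicCube (hs : 0 < s) (h : OscLEOne U ψ) {c : DyadicIndex n}
    (hc : dyadicCube s c ⊆ U) :
    ∫⁻ x in dyadicCube s c, ‖ψ x - dyadicMean s ψ c‖ₑ ≤ volume (dyadicCube s c) := by
  have h1 := h _ _ (half_pos (dyadicSide_pos hs c.1)) ((ball_subset_dyadicCube hs c).trans hc)
  have h2 := dyadicCube_ae_eq_ball hs c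
  unfold dyadicMean
  rwa [setLIntegral_congr h2, measure_congr h2, setAverage_congr h2]

/-- Decompose `|ψ - ψ_Q|` at level 2. The selected cubes fill at most half of `Q`, their means
differ from `ψ_Q` by at most `2 * 2 ^ n`, and off them the oscillation is at most 2. So raising the
level by `2 ^ (n + 1)` halves the measure. -/
theorem johnNirenberg (hs : 0 < s) (hint : IntegrableOn ψ U) (h : OscLEOne U ψ) (m : ℕ) :
    ∀ c : DyadicIndex n, BMOInterp.dyadicCube s c ⊆ U →
      2 ^ m * volume {x ∈ BMOInterp.dyadicCube s c |
        (m : ℝ) * 2 ^ (n + 1) < |ψ x - dyadicMean s ψ c|} ≤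
      volume (BMOInterp.dyadicCube s c) := by
  induction m with
  | zero =>
    intro c _
    rw [pow_zero, one_mul]
    exact measure_mono (Set.sep_subset _ _)
  | succ m ih =>
    intro c hc
    have hosc := h.dyadicCube hs hc
    have hintc := hint.mono_set hc
    have hm := measurableSet_dyadicCube hs c
    have hg : AEMeasurable (fun x => ‖ψ x - dyadicMean s ψ c‖ₑ)
        (volume.restrict (BMOInterp.dyadicCube s c)) :=
      (hintc.aestronglyMeasurable.sub aestronglyMeasurable_const).enorm
    obtain ⟨T, hdisj, hT, hae⟩ := exists_calderonZygmund hs c hg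
      (ne_top_of_le_ne_top (volume_dyadicCube_ne_top hs c) hosc) (a := 2)
      (hosc.trans (le_mul_of_one_le_left zero_le one_le_two))
    have hmean : ∀ c' ∈ T, |dyadicMean s ψ c' - dyadicMean s ψ c| ≤ 2 ^ (n + 1) := by
      intro c' hc'
      obtain ⟨hsub, -, hle⟩ := hT c' hc'
      refine abs_average_sub_le (volume_dyadicCube_ne_zero hs c') (volume_dyadicCube_ne_top hs c')
        (hintc.mono_set hsub) (by positivity) (hle.trans (le_of_eq ?_))
      rw [ENNReal.ofReal_pow (by norm_num), pow_succ]
      simp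
    set A : DyadicIndex n → Set (Fin n → ℝ) := fun c' => {x ∈ BMOInterp.dyadicCube s c' |
        (m : ℝ) * 2 ^ (n + 1) < |ψ x - dyadicMean s ψ c'|} with hA
    have hcover : volume {x ∈ BMOInterp.dyadicCube s c |
        ((m + 1 : ℕ) : ℝ) * 2 ^ (n + 1) < |ψ x - dyadicMean s ψ c|} ≤
        volume (⋃ c' : T, A c') := by
      apply measure_mono_ae
      rw [ae_restrict_iff' hm] at hae
      filter_upwards [hae] with x hx
      rintro ⟨hxc, hlt⟩
      refine Set.mem_iUnion.2 ?_
      have h1 : (1 : ℝ) ≤ 2 ^ n := one_le_pow₀ (by norm_num)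
      have h1' : (2 : ℝ) ^ (n + 1) = 2 * 2 ^ n := by ring
      have hm0 : (0 : ℝ) ≤ m := Nat.cast_nonneg m
      push_cast at hlt
      by_contra hcon
      have hle := hx hxc fun c' hc' hxc' => hcon ⟨⟨c', hc'⟩, hxc', by
        have h2 := hmean c' hc'
        have h3 := abs_sub_le (ψ x) (dyadicMean s ψ c') (dyadicMean s ψ c)
        linarith⟩
      rw [Real.enorm_eq_ofReal_abs, show (2 : ℝ≥0∞) = ENNReal.ofReal 2 by simp,
        ENNReal.ofReal_le_ofReal_iff (by norm_num)] at hle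
      nlinarith [mul_nonneg hm0 (by positivity : (0 : ℝ) ≤ 2 ^ (n + 1))]
    calc 2 ^ (m + 1) * volume {x ∈ BMOInterp.dyadicCube s c |
          ((m + 1 : ℕ) : ℝ) * 2 ^ (n + 1) < |ψ x - dyadicMean s ψ c|}
        ≤ 2 ^ (m + 1) * ∑' c' : T, volume (A c') := by
          gcongr; exact hcover.trans (measure_iUnion_le _)
      -- The factor `2 ^ m` is for the induction hypothesis, the remaining 2 for the selection
      -- inequality.
      _ = ∑' c' : T, 2 * (2 ^ m * volume (A c')) := by
          rw [← ENNReal.tsum_mul_left]; congr 1; ext c'; ring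
      _ ≤ ∑' c' : T, ∫⁻ x in BMOInterp.dyadicCube s (c' : DyadicIndex n),
            ‖ψ x - dyadicMean s ψ c‖ₑ := by
          refine ENNReal.tsum_le_tsum fun c' => ?_
          refine le_trans ?_ (hT c' c'.2).2.1.le
          gcongr
          exact ih c' ((hT c' c'.2).1.trans hc)
      _ = ∫⁻ x in ⋃ c' : T, BMOInterp.dyadicCube s (c' : DyadicIndex n),
            ‖ψ x - dyadicMean s ψ c‖ₑ := by
          rw [lintegral_iUnion (fun c' => measurableSet_dyadicCube hs _)]
          exact fun a b hab => hdisj a.2 b.2 (fun hh => hab (Subtype.ext hh))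
      _ ≤ ∫⁻ x in BMOInterp.dyadicCube s c, ‖ψ x - dyadicMean s ψ c‖ₑ :=
          lintegral_mono_set (Set.iUnion_subset fun c' => (hT c' c'.2).1)
      _ ≤ _ := hosc

lemma tsum_pow_mul_geometric_ne_top (b m : ℕ) :
    ∑' j : ℕ, (((j + 1) * b : ℕ) : ℝ≥0∞) ^ m * (2⁻¹) ^ j ≠ ∞ := by
  have hsum : Summable fun j : ℕ => ((((j + 1) * b : ℕ) : ℝ)) ^ m * (1 / 2) ^ j := by
    have h1 := (summable_nat_add_iff 1).2
      (summable_pow_mul_geometric_of_norm_lt_one (R := ℝ) m (r := 1 / 2) (by norm_num))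
    refine (h1.mul_left ((b : ℝ) ^ m * 2)).congr fun j => ?_
    push_cast
    rw [mul_pow, pow_succ]; ring
  convert hsum.tsum_ofReal_ne_top using 4 with j
  rw [ENNReal.ofReal_mul (by positivity), ENNReal.ofReal_pow (by positivity),
    ENNReal.ofReal_pow (by positivity), ENNReal.ofReal_natCast]
  congr 2
  rw [one_div, ENNReal.ofReal_inv_of_pos (by norm_num)]
  simp

/-- Cut the range of the oscillation into layers of height `2 ^ (n + 1)`: the integrand grows
polynomially in the layer number and the measure decays geometrically. -/
theorem exists_lintegral_osc_pow_le (n m : ℕ) (hm : m ≠ 0) :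
    ∃ K : ℝ≥0∞, K ≠ ∞ ∧ ∀ (s : ℝ) (U : Set (Fin n → ℝ)) (ψ : (Fin n → ℝ) → ℝ), 0 < s →
      IntegrableOn ψ U → OscLEOne U ψ → ∀ c : DyadicIndex n, BMOInterp.dyadicCube s c ⊆ U →
        ∫⁻ x in BMOInterp.dyadicCube s c, ‖ψ x - dyadicMean s ψ c‖ₑ ^ m ≤
          K * volume (BMOInterp.dyadicCube s c) := by
  refine ⟨_, tsum_pow_mul_geometric_ne_top (2 ^ (n + 1)) m, ?_⟩
  intro s U ψ hs hint h c hc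
  have hmc := measurableSet_dyadicCube hs c
  have hintc := hint.mono_set hc
  set μ := volume.restrict (BMOInterp.dyadicCube s c) with hμ
  set B : ℕ → Set (Fin n → ℝ) :=
    fun j => {x | (j : ℝ) * 2 ^ (n + 1) < |ψ x - dyadicMean s ψ c|} with hB
  have hBm : ∀ j, NullMeasurableSet (B j) μ := fun j =>
    nullMeasurableSet_lt aemeasurable_const
      (hintc.aestronglyMeasurable.aemeasurable.sub aemeasurable_const).norm
  have hpt : ∀ x, ‖ψ x - dyadicMean s ψ c‖ₑ ^ m ≤
      ∑' j : ℕ, (B j).indicator (fun _ => (((j + 1) * 2 ^ (n + 1) : ℕ) : ℝ≥0∞) ^ m) x := by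
    intro x
    -- A zero of the oscillation lies in no layer, so its power must vanish there; this is where `m
    -- ≠ 0` matters.
    by_cases h0 : ψ x - dyadicMean s ψ c = 0
    · simp [h0, hm]
    have hΛ : (0 : ℝ) < 2 ^ (n + 1) := by positivity
    have hpos : 0 < |ψ x - dyadicMean s ψ c| / 2 ^ (n + 1) := div_pos (abs_pos.2 h0) hΛ
    obtain ⟨j, hj⟩ : ∃ j, ⌈|ψ x - dyadicMean s ψ c| / 2 ^ (n + 1)⌉₊ = j + 1 :=
      ⟨_, (Nat.succ_pred_eq_of_pos (Nat.ceil_pos.2 hpos)).symm⟩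
    rw [Nat.ceil_eq_iff (by omega)] at hj
    obtain ⟨hj1, hj2⟩ := hj
    rw [lt_div_iff₀ hΛ] at hj1
    rw [div_le_iff₀ hΛ] at hj2
    refine le_trans ?_ (ENNReal.le_tsum j)
    rw [Set.indicator_of_mem (by simpa [hB] using hj1)]
    gcongr
    rw [Real.enorm_eq_ofReal_abs, ← ENNReal.ofReal_natCast]
    apply ENNReal.ofReal_le_ofReal
    push_cast at hj2 ⊢
    exact hj2
  calc ∫⁻ x, ‖ψ x - dyadicMean s ψ c‖ₑ ^ m ∂μ
      ≤ ∫⁻ x, ∑' j : ℕ, (B j).indicator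
          (fun _ => (((j + 1) * 2 ^ (n + 1) : ℕ) : ℝ≥0∞) ^ m) x ∂μ := lintegral_mono hpt
    _ = ∑' j : ℕ, (((j + 1) * 2 ^ (n + 1) : ℕ) : ℝ≥0∞) ^ m * μ (B j) := by
        rw [lintegral_tsum fun j => (aemeasurable_const.indicator₀ (hBm j))]
        congr 1; ext j
        rw [lintegral_indicator₀ (hBm j), setLIntegral_const]
    _ ≤ ∑' j : ℕ, (((j + 1) * 2 ^ (n + 1) : ℕ) : ℝ≥0∞) ^ m *
          ((2⁻¹) ^ j * volume (BMOInterp.dyadicCube s c)) := by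
        refine ENNReal.tsum_le_tsum fun j => ?_
        gcongr
        have h1 := johnNirenberg hs hint h j c hc
        have h2 : μ (B j) = volume {x ∈ BMOInterp.dyadicCube s c |
            (j : ℝ) * 2 ^ (n + 1) < |ψ x - dyadicMean s ψ c|} := by
          rw [hμ, Measure.restrict_apply₀ (hBm j), Set.inter_comm]; rfl
        rw [h2, ← ENNReal.inv_pow, ← ENNReal.div_eq_inv_mul,
          ENNReal.le_div_iff_mul_le (by simp) (by simp), mul_comm]
        exact h1
    _ = _ := by
        rw [← ENNReal.tsum_mul_right]; congr 1; ext j; ring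

theorem exists_lintegral_pow_le (n m : ℕ) (hm : m ≠ 0) :
    ∃ K : ℝ≥0∞, K ≠ ∞ ∧ ∀ (s : ℝ) (U : Set (Fin n → ℝ)) (ψ : (Fin n → ℝ) → ℝ), 0 < s →
      IntegrableOn ψ U → OscLEOne U ψ → ∀ c : DyadicIndex n, BMOInterp.dyadicCube s c ⊆ U →
        ∫⁻ x in BMOInterp.dyadicCube s c, ‖ψ x‖ₑ ^ m ≤
          K * (1 + ‖dyadicMean s ψ c‖ₑ ^ m) * volume (BMOInterp.dyadicCube s c) := by
  obtain ⟨K, hK, hosc⟩ := exists_lintegral_osc_pow_le n m hm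
  refine ⟨2 ^ m * (K + 1), ENNReal.mul_ne_top (by simp) (by simp [hK]), ?_⟩
  intro s U ψ hs hint h c hc
  have h1 := hosc s U ψ hs hint h c hc
  set f := dyadicMean s ψ c
  set V := volume (BMOInterp.dyadicCube s c)
  calc ∫⁻ x in BMOInterp.dyadicCube s c, ‖ψ x‖ₑ ^ m
      ≤ ∫⁻ x in BMOInterp.dyadicCube s c, 2 ^ m * (‖ψ x - f‖ₑ ^ m + ‖f‖ₑ ^ m) := by
        refine lintegral_mono fun x => le_trans ?_ (add_pow_le_two_pow_mul _ _ m)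
        gcongr
        simpa using enorm_add_le (ψ x - f) f
    _ = 2 ^ m * ((∫⁻ x in BMOInterp.dyadicCube s c, ‖ψ x - f‖ₑ ^ m) + ‖f‖ₑ ^ m * V) := by
        rw [lintegral_const_mul' _ _ (by simp), lintegral_add_right' _ aemeasurable_const,
          setLIntegral_const]
    _ ≤ 2 ^ m * (K * V + ‖f‖ₑ ^ m * V) := by gcongr
    -- The added terms complete the product `(K + 1) * (1 + ‖f‖ₑ ^ m)`.
    _ ≤ 2 ^ m * (K * V + ‖f‖ₑ ^ m * V + (K * ‖f‖ₑ ^ m * V + V)) := by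
        exact mul_le_mul' le_rfl le_self_add
    _ = _ := by ring

end JohnNirenberg

/-! ### Chains and their multiplicities -/

lemma succ_pow_succ_le (k m : ℕ) :
    (k + 1) ^ (m + 1) ≤ k ^ (m + 1) + (m + 1) * (k + 1) ^ m := by
  induction m with
  | zero => simp
  | succ m ih =>
    have h1 : k ^ (m + 1) ≤ (k + 1) ^ (m + 1) := Nat.pow_le_pow_left (Nat.le_succ k) _
    calc (k + 1) ^ (m + 1 + 1) = (k + 1) ^ (m + 1) * (k + 1) := pow_succ _ _
      _ ≤ (k ^ (m + 1) + (m + 1) * (k + 1) ^ m) * (k + 1) := Nat.mul_le_mul_right _ ih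
      _ = k ^ (m + 1 + 1) + (k ^ (m + 1) + (m + 1) * (k + 1) ^ (m + 1)) := by ring
      _ ≤ k ^ (m + 1 + 1) + ((k + 1) ^ (m + 1) + (m + 1) * (k + 1) ^ (m + 1)) := by gcongr
      _ = _ := by ring

open Classical in
-- A discrete form of `N^(m+1) = (m+1) ∫₀ᴺ t^m dt`: in increasing order of `l`, the `k`-th member
-- has at least `k` members not above it.
lemma card_pow_succ_le_sum {I : Type*} (l : I → ℝ) (m : ℕ) (G : Finset I) :
    G.card ^ (m + 1) ≤ (m + 1) * ∑ P ∈ G, (G.filter fun P' => l P' ≤ l P).card ^ m := by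
  induction G using Finset.induction_on_max_value l with
  | empty => simp
  | insert a G ha hmax ih =>
    rw [Finset.card_insert_of_notMem ha, Finset.sum_insert ha]
    have h1 : (insert a G).filter (fun P' => l P' ≤ l a) = insert a G :=
      Finset.filter_true_of_mem fun P hP => by
        rcases Finset.mem_insert.1 hP with rfl | h
        · exact le_rfl
        · exact hmax P h
    rw [h1, Finset.card_insert_of_notMem ha, mul_add, add_comm ((m + 1) * _)]
    refine (succ_pow_succ_le _ _).trans (Nat.add_le_add_right (ih.trans ?_) _)
    gcongr
    exact Finset.subset_insert a G

open Classical in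
-- This stands in for an exponential estimate of chain lengths. By `card_pow_succ_le_sum` one factor
-- of the power becomes a sum over the largest cube `P`. By `hR` the other cubes counted are
-- `R'`-close to `P`, so the induction hypothesis applies to these cubes only, and packing bounds
-- their total weight by `K * w P`. Two relations are needed because passing through a common cube
-- worsens the constant.
theorem sum_mul_card_pow_le {I : Type*} {w : I → ℝ≥0∞} {l : I → ℝ} {W : Set I}
    {R R' : I → I → Prop} {K : ℝ≥0∞} (hRR' : ∀ Q P, R Q P → R' Q P)
    (hpack : ∀ P₀ ∈ W, ∀ G : Finset I, (G : Set I) ⊆ W → (∀ P ∈ G, R' P P₀) →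
      ∑ P ∈ G, w P ≤ K * w P₀)
    (hR : ∀ Q P P', R Q P → R Q P' → l P' ≤ l P → R' P' P) (m : ℕ) :
    ∀ F G : Finset I, (F : Set I) ⊆ W → (G : Set I) ⊆ W →
      ∑ Q ∈ F, w Q * ((G.filter fun P => R Q P).card : ℝ≥0∞) ^ (m + 1) ≤
        (m + 1).factorial * K ^ (m + 1) * ∑ P ∈ G, w P := by
  induction m with
  | zero =>
    intro F G hF hG
    calc ∑ Q ∈ F, w Q * ((G.filter fun P => R Q P).card : ℝ≥0∞) ^ (0 + 1)
        = ∑ Q ∈ F, ∑ P ∈ G, if R Q P then w Q else 0 := by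
          refine Finset.sum_congr rfl fun Q _ => ?_
          rw [← Finset.sum_filter, Finset.sum_const, zero_add, pow_one, nsmul_eq_mul, mul_comm]
      _ = ∑ P ∈ G, ∑ Q ∈ F.filter (fun Q => R Q P), w Q := by
          rw [Finset.sum_comm]
          refine Finset.sum_congr rfl fun P _ => ?_
          rw [Finset.sum_filter]
      _ ≤ ∑ P ∈ G, K * w P := by
          refine Finset.sum_le_sum fun P hP => hpack P (hG hP) _ ?_ fun Q hQ =>
            hRR' _ _ (Finset.mem_filter.1 hQ).2
          exact fun Q hQ => hF (Finset.mem_filter.1 hQ).1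
      _ = _ := by rw [← Finset.mul_sum]; simp
  | succ m ih =>
    intro F G hF hG
    have hsub : ∀ P, ((G.filter fun P' => R' P' P : Finset I) : Set I) ⊆ W :=
      fun P P' hP' => hG (Finset.mem_filter.1 hP').1
    have hpt : ∀ Q, ((G.filter fun P => R Q P).card : ℝ≥0∞) ^ (m + 1 + 1) ≤
        (m + 1 + 1 : ℕ) * ∑ P ∈ G,
          (((G.filter fun P' => R' P' P).filter fun P' => R Q P').card : ℝ≥0∞) ^ (m + 1) := by
      intro Q
      have h1 := card_pow_succ_le_sum l (m + 1) (G.filter fun P => R Q P)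
      have h2 : ∑ P ∈ G.filter (fun P => R Q P),
          ((G.filter fun P => R Q P).filter fun P' => l P' ≤ l P).card ^ (m + 1) ≤
          ∑ P ∈ G, ((G.filter fun P' => R' P' P).filter fun P' => R Q P').card ^ (m + 1) := by
        refine (Finset.sum_le_sum fun P hP => ?_).trans
          (Finset.sum_le_sum_of_subset (Finset.filter_subset _ _))
        gcongr
        intro P' hP'
        simp only [Finset.mem_filter] at hP hP' ⊢
        exact ⟨⟨hP'.1.1, hR Q P P' hP.2 hP'.1.2 hP'.2⟩, hP'.1.2⟩
      exact_mod_cast h1.trans (Nat.mul_le_mul_left _ h2)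
    calc ∑ Q ∈ F, w Q * ((G.filter fun P => R Q P).card : ℝ≥0∞) ^ (m + 1 + 1)
        ≤ ∑ Q ∈ F, w Q * ((m + 1 + 1 : ℕ) * ∑ P ∈ G,
          (((G.filter fun P' => R' P' P).filter fun P' => R Q P').card : ℝ≥0∞) ^ (m + 1)) := by
          gcongr with Q _
          exact hpt Q
      _ = (m + 1 + 1 : ℕ) * ∑ P ∈ G, ∑ Q ∈ F, w Q *
          (((G.filter fun P' => R' P' P).filter fun P' => R Q P').card : ℝ≥0∞) ^ (m + 1) := by
          rw [Finset.sum_comm, Finset.mul_sum]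
          refine Finset.sum_congr rfl fun Q _ => ?_
          rw [← Finset.mul_sum]; ring
      _ ≤ (m + 1 + 1 : ℕ) * ∑ P ∈ G, (m + 1).factorial * K ^ (m + 1) * (K * w P) := by
          gcongr with P hP
          refine (ih F _ hF (hsub P)).trans ?_
          gcongr
          exact hpack P (hG hP) _ (hsub P) fun P' hP' => (Finset.mem_filter.1 hP').2
      _ = _ := by
          rw [← Finset.mul_sum, ← Finset.mul_sum, Nat.factorial_succ (m + 1)]
          push_cast; ring

open Classical in
-- Loops are cut out: if the head recurs, the chain restarts at the later occurrence. The number of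
-- steps is not controlled, so only distinct members may be counted.
theorem abs_sub_getLast_le_card {I : Type*} (f : I → ℝ) {C : ℝ} (hC : 0 ≤ C) (N : ℕ) :
    ∀ (a : I) (L : List I), L.length ≤ N → (a :: L).IsChain (fun x y => |f x - f y| ≤ C) →
      |f a - f ((a :: L).getLast (by simp))| ≤ C * (a :: L).toFinset.card := by
  induction N with
  | zero =>
    intro a L hL _
    obtain rfl := List.length_eq_zero_iff.1 (Nat.le_zero.1 hL)
    simpa using hC
  | succ N ih =>
    intro a L hL hch
    by_cases ha : a ∈ L
    · obtain ⟨u, v, rfl⟩ := List.append_of_mem ha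
      have h1 : (a :: v).IsChain (fun x y => |f x - f y| ≤ C) :=
        hch.suffix ⟨a :: u, by simp⟩
      have h2 := ih a v (by simp at hL; omega) h1
      have h3 : (a :: (u ++ a :: v)).getLast (by simp) = (a :: v).getLast (by simp) := by
        rw [List.getLast_cons (by simp), List.getLast_append_of_right_ne_nil _ _ (by simp)]
      rw [h3]
      refine h2.trans ?_
      gcongr
      intro y
      simp only [List.mem_toFinset, List.mem_cons, List.mem_append]
      tauto
    · cases L with
      | nil => simpa using hC
      | cons b L =>
        rw [List.isChain_cons_cons] at hch
        have h2 := ih b L (by simp at hL; omega) hch.2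
        rw [List.getLast_cons (by simp), List.toFinset_cons, Finset.card_insert_of_notMem
          (by simpa using ha)]
        push_cast
        have h3 := abs_sub_le (f a) (f b) (f ((b :: L).getLast (by simp)))
        linarith [hch.1]

lemma exists_append_of_not_getLast {I : Type*} (Bd : I → Prop) (L : List I) :
    ∀ a, Bd a → ¬ Bd ((a :: L).getLast (by simp)) →
      ∃ L₁ g L₂, a :: L = (a :: L₁) ++ g :: L₂ ∧ Bd ((a :: L₁).getLast (by simp)) ∧ ¬ Bd g := by
  induction L with
  | nil => intro a h1 h2; exact absurd h1 h2
  | cons b L ih =>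
    intro a ha hl
    by_cases hb : Bd b
    · rw [List.getLast_cons (by simp)] at hl
      obtain ⟨L₁, g, L₂, h1, h2, h3⟩ := ih b hb hl
      refine ⟨b :: L₁, g, L₂, by rw [h1]; rfl, ?_, h3⟩
      rwa [List.getLast_cons (by simp)]
    · exact ⟨[], b, L, rfl, by simpa using ha, hb⟩

lemma pairwise_getLast {I : Type*} {R : I → I → Prop} (hrefl : ∀ P, R P P) {L : List I}
    (hne : L ≠ []) (h : L.Pairwise R) : ∀ P ∈ L, R P (L.getLast hne) := by
  intro P hP
  rw [← List.dropLast_append_getLast hne, List.pairwise_append] at h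
  rw [← List.dropLast_append_getLast hne, List.mem_append] at hP
  rcases hP with hP | hP
  · exact h.2.2 P hP _ (by simp)
  · rw [List.mem_singleton.1 hP]; exact hrefl _

open Classical in
-- The chain is cut where it leaves `Bd`. The prefix, as a set, puts `a` in the shadow of `q`, which
-- still satisfies `Bd`; its successor `g` does not, and so controls `f q`.
theorem exists_stopped_chain {I : Type*} {f : I → ℝ} {C : ℝ} (hC : 0 ≤ C) {R : I → I → Prop}
    (hrefl : ∀ P, R P P) (Bd : I → Prop) {a : I} {L : List I}
    (hch : (a :: L).IsChain (fun x y => |f x - f y| ≤ C)) (hR : (a :: L).Pairwise R)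
    (ha : Bd a) (hl : ¬ Bd ((a :: L).getLast (by simp))) :
    ∃ q ∈ a :: L, ∃ g ∈ a :: L, Bd q ∧ ¬ Bd g ∧ |f q - f g| ≤ C ∧ ∃ G : Finset I,
      (∀ P ∈ G, P ∈ a :: L ∧ R a P ∧ R P q) ∧ a ∈ G ∧ |f a - f q| ≤ C * G.card := by
  obtain ⟨L₁, g, L₂, hL, hq, hg⟩ := exists_append_of_not_getLast Bd L a ha hl
  have hmem : ∀ P ∈ a :: L₁, P ∈ a :: L := fun P hP => by
    rw [hL]; exact List.mem_append_left _ hP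
  have hlast := List.getLast_mem (l := a :: L₁) (by simp)
  have hchain := hch
  rw [hL, List.isChain_append] at hchain
  rw [hL, List.pairwise_append] at hR
  refine ⟨_, hmem _ hlast, g, by rw [hL]; simp, hq, hg, ?_, (a :: L₁).toFinset, ?_, by simp, ?_⟩
  · refine hchain.2.2 _ ?_ g (by simp)
    rw [List.getLast?_eq_getLast_of_ne_nil (by simp)]
    simp
  · intro P hP
    rw [List.mem_toFinset] at hP
    refine ⟨hmem P hP, ?_, pairwise_getLast hrefl _ hR.1 P hP⟩
    rcases List.mem_cons.1 hP with rfl | h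
    · exact hrefl _
    · exact (List.pairwise_cons.1 hR.1).1 P h
  · exact abs_sub_getLast_le_card f hC _ a L₁ le_rfl hchain.1

/-! ### Whitney cubes -/

/-- The Whitney cubes of `U`: the maximal dyadic cubes whose distance to the complement is at least
eight times their side. -/
def whitneyCubes {n : ℕ} (s : ℝ) (U : Set (Fin n → ℝ)) : Set (DyadicIndex n) :=
  maximalDyadic s {c | 8 * dyadicSide s c.1 ≤ Metric.infDist (dyadicCenter s c) Uᶜ}

/-- The cube `P` is contained in a multiple of the cube `Q`. -/
def DyadicNear {n : ℕ} (s A : ℝ) (P Q : DyadicIndex n) : Prop :=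
  dist (dyadicCenter s P) (dyadicCenter s Q) ≤ A * dyadicSide s Q.1 ∧
    dyadicSide s P.1 ≤ A * dyadicSide s Q.1

/-- Every point of `U` is joined to `x₀` by a chain of points with steps small compared with the
distance to the complement, and along which the distance to the complement is at least comparable
with the distance to all earlier points. -/
def ChainCondition {X : Type*} [PseudoMetricSpace X] (U : Set X) (x₀ : X) (ε A : ℝ) : Prop :=
  ∀ x ∈ U, ∃ L : List X, (∀ y ∈ x :: L, y ∈ U) ∧
    (x :: L).IsChain (fun y z => dist y z ≤ ε * Metric.infDist y Uᶜ) ∧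
    (x :: L).Pairwise (fun y z => dist y z ≤ A * Metric.infDist z Uᶜ) ∧
    (x :: L).getLast (by simp) = x₀

lemma ball_infDist_compl_subset {X : Type*} [PseudoMetricSpace X] (U : Set X) (x : X) :
    Metric.ball x (Metric.infDist x Uᶜ) ⊆ U := by
  intro y hy
  by_contra hcon
  have := Metric.infDist_le_dist_of_mem (x := x) (show y ∈ Uᶜ from hcon)
  rw [Metric.mem_ball, dist_comm] at hy
  linarith

section Whitney

variable {n : ℕ} {s : ℝ} {U : Set (Fin n → ℝ)}

lemma le_infDist_of_mem_whitneyCubes (hs : 0 < s) {c : DyadicIndex n} (hc : c ∈ whitneyCubes s U)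
    {x : Fin n → ℝ} (hx : x ∈ dyadicCube s c) :
    7 * dyadicSide s c.1 ≤ Metric.infDist x Uᶜ := by
  have h1 : 8 * dyadicSide s c.1 ≤ Metric.infDist (dyadicCenter s c) Uᶜ := hc.1
  have h2 := Metric.infDist_le_infDist_add_dist (s := Uᶜ) (x := dyadicCenter s c) (y := x)
  have h3 := Metric.mem_closedBall'.1 (dyadicCube_subset_closedBall hs c hx)
  linarith [dyadicSide_pos hs c.1]

/-- By `hbig` no cube of generation 0 qualifies, so a Whitney cube of side `ℓ` has a parent that
fails the test. The centre of the parent is less than `16 ℓ` from the complement and at most `ℓ`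
from `x`. -/
lemma infDist_le_of_mem_whitneyCubes (hs : 0 < s)
    (hbig : ∀ y, Metric.infDist y Uᶜ < 8 * s) {c : DyadicIndex n} (hc : c ∈ whitneyCubes s U)
    {x : Fin n → ℝ} (hx : x ∈ dyadicCube s c) :
    Metric.infDist x Uᶜ ≤ 17 * dyadicSide s c.1 := by
  obtain ⟨k, z⟩ := c
  cases k with
  | zero =>
    have h1 : 8 * dyadicSide s 0 ≤ Metric.infDist (dyadicCenter s (0, z)) Uᶜ := hc.1
    have h2 := hbig (dyadicCenter s (0, z))
    simp only [dyadicSide, pow_zero, div_one] at h1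
    linarith
  | succ j =>
    have hmem := mem_dyadicCube_self s j x
    have h1 := hc.2 j (Nat.lt_succ_self j) _
      (dyadicCube_subset_of_mem (Nat.le_succ j) hmem hx)
    rw [Set.mem_ofPred_eq, not_le] at h1
    have h2 := Metric.infDist_le_infDist_add_dist (s := Uᶜ) (x := x)
      (y := dyadicCenter s (j, dyadicCoord s j x))
    have h3 := Metric.mem_closedBall.1 (dyadicCube_subset_closedBall hs _ hmem)
    have h4 := dyadicSide_succ s j
    simp only at h1 h2 h3 ⊢
    linarith

lemma dyadicCube_subset_of_mem_whitneyCubes (hs : 0 < s) {c : DyadicIndex n}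
    (hc : c ∈ whitneyCubes s U) : dyadicCube s c ⊆ U := by
  intro x hx
  have h1 := le_infDist_of_mem_whitneyCubes hs hc hx
  have h2 := dyadicSide_pos hs c.1
  exact ball_infDist_compl_subset U x (Metric.mem_ball_self (by linarith))

lemma exists_mem_whitneyCubes (hs : 0 < s) (hU : IsOpen U) (hne : Uᶜ.Nonempty) {x : Fin n → ℝ}
    (hx : x ∈ U) : ∃ c ∈ whitneyCubes s U, x ∈ dyadicCube s c := by
  have hpos : 0 < Metric.infDist x Uᶜ :=
    (hU.isClosed_compl.notMem_iff_infDist_pos hne).1 (by simpa using hx)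
  -- With nine sides at `x`, at least eight remain at the centre, half a side away.
  obtain ⟨k, hk⟩ := ((tendsto_dyadicSide s).eventually_lt_const
    (show 0 < Metric.infDist x Uᶜ / 9 by positivity)).exists
  refine exists_mem_maximalDyadic (c := (k, dyadicCoord s k x)) ?_ (mem_dyadicCube_self s k x)
  have h2 := Metric.infDist_le_infDist_add_dist (s := Uᶜ) (x := x)
      (y := dyadicCenter s (k, dyadicCoord s k x))
  have h3 := Metric.mem_closedBall.1
    (dyadicCube_subset_closedBall hs _ (mem_dyadicCube_self s k x))
  have h4 := dyadicSide_pos hs k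
  rw [Set.mem_ofPred_eq]
  simp only at h2 h3 ⊢
  linarith

lemma iUnion_whitneyCubes (hs : 0 < s) (hU : IsOpen U) (hne : Uᶜ.Nonempty) :
    ⋃ c : whitneyCubes s U, dyadicCube s (c : DyadicIndex n) = U := by
  refine Set.Subset.antisymm
    (Set.iUnion_subset fun c => dyadicCube_subset_of_mem_whitneyCubes hs c.2) fun x hx => ?_
  obtain ⟨c, hc, hxc⟩ := exists_mem_whitneyCubes hs hU hne hx
  exact Set.mem_iUnion.2 ⟨⟨c, hc⟩, hxc⟩

lemma lintegral_eq_tsum_whitneyCubes (hs : 0 < s) (hU : IsOpen U) (hne : Uᶜ.Nonempty)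
    (g : (Fin n → ℝ) → ℝ≥0∞) :
    ∫⁻ x in U, g x = ∑' c : whitneyCubes s U, ∫⁻ x in dyadicCube s (c : DyadicIndex n), g x := by
  rw [← lintegral_iUnion (fun c => measurableSet_dyadicCube hs _), iUnion_whitneyCubes hs hU hne]
  exact fun a b hab => disjoint_of_mem_maximalDyadic a.2 b.2 fun hh => hab (Subtype.ext hh)

lemma DyadicNear.refl (hs : 0 < s) {A : ℝ} (hA : 1 ≤ A) (P : DyadicIndex n) :
    DyadicNear s A P P := by
  have := dyadicSide_pos hs P.1
  refine ⟨by rw [dist_self]; positivity, by nlinarith⟩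

/-- This supplies `hR` in `sum_mul_card_pow_le`; adding the two distances doubles the constant. -/
lemma DyadicNear.of_common (hs : 0 < s) {A : ℝ} (hA : 1 ≤ A) {Q P P' : DyadicIndex n}
    (h : DyadicNear s A Q P) (h' : DyadicNear s A Q P')
    (hle : dyadicSide s P'.1 ≤ dyadicSide s P.1) : DyadicNear s (2 * A) P' P := by
  have hP := dyadicSide_pos hs P.1
  have h1 := dist_triangle_left (dyadicCenter s P') (dyadicCenter s P) (dyadicCenter s Q)
  have h2 := h.1
  have h3 := h'.1
  have h4 : A * dyadicSide s P'.1 ≤ A * dyadicSide s P.1 := by gcongr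
  exact ⟨by linarith, by nlinarith⟩

lemma DyadicNear.mono (hs : 0 < s) {A A' : ℝ} (hA : A ≤ A') {Q P : DyadicIndex n}
    (h : DyadicNear s A Q P) : DyadicNear s A' Q P := by
  have hP := dyadicSide_pos hs P.1
  exact ⟨h.1.trans (by gcongr), h.2.trans (by gcongr)⟩

/-- With `d` the distance to the complement, `7 ℓ(P) ≤ d(x) ≤ (1 + A) d(y) ≤ 17 (1 + A) ℓ(Q)`, and
each centre is within half a side of its point. -/
lemma dyadicNear_of_dist_le (hs : 0 < s) (hbig : ∀ y, Metric.infDist y Uᶜ < 8 * s) {A : ℝ}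
    (hA : 0 ≤ A) {P Q : DyadicIndex n} (hP : P ∈ whitneyCubes s U) (hQ : Q ∈ whitneyCubes s U)
    {x y : Fin n → ℝ} (hx : x ∈ dyadicCube s P) (hy : y ∈ dyadicCube s Q)
    (hxy : dist x y ≤ A * Metric.infDist y Uᶜ) : DyadicNear s (20 * (1 + A)) P Q := by
  have hlP := dyadicSide_pos hs P.1
  have hlQ := dyadicSide_pos hs Q.1
  have h1 := le_infDist_of_mem_whitneyCubes hs hP hx
  have h2 := infDist_le_of_mem_whitneyCubes hs hbig hQ hy
  have h3 := Metric.infDist_le_infDist_add_dist (s := Uᶜ) (x := x) (y := y)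
  have h4 : A * Metric.infDist y Uᶜ ≤ A * (17 * dyadicSide s Q.1) := by gcongr
  have h5 := Metric.mem_closedBall'.1 (dyadicCube_subset_closedBall hs _ hx)
  have h6 := Metric.mem_closedBall.1 (dyadicCube_subset_closedBall hs _ hy)
  have h7 := dist_triangle4 (dyadicCenter s P) x y (dyadicCenter s Q)
  have h8 : 0 ≤ A * dyadicSide s Q.1 := by positivity
  have h9 : dyadicSide s P.1 ≤ 3 * (1 + A) * dyadicSide s Q.1 := by nlinarith
  exact ⟨by nlinarith, by nlinarith⟩

/-- The packing property: these cubes are disjoint and lie in one ball of radius comparable to the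
side of `P₀`. -/
theorem sum_volume_le_of_dyadicNear (hs : 0 < s) {A : ℝ} (hA : 1 ≤ A) (P₀ : DyadicIndex n)
    (G : Finset (DyadicIndex n)) (hG : (G : Set (DyadicIndex n)) ⊆ whitneyCubes s U)
    (hR : ∀ P ∈ G, DyadicNear s A P P₀) :
    ∑ P ∈ G, volume (dyadicCube s P) ≤ ENNReal.ofReal ((4 * A) ^ n) * volume (dyadicCube s P₀) := by
  have hl := dyadicSide_pos hs P₀.1
  rw [← measure_biUnion_finset
    (fun a ha b hb hab => disjoint_of_mem_maximalDyadic (hG ha) (hG hb) hab)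
    (fun P _ => measurableSet_dyadicCube hs P)]
  calc volume (⋃ P ∈ G, dyadicCube s P)
      ≤ volume (Metric.closedBall (dyadicCenter s P₀) (2 * A * dyadicSide s P₀.1)) := by
        refine measure_mono (Set.iUnion₂_subset fun P hP x hx => ?_)
        obtain ⟨h1, h2⟩ := hR P hP
        have h3 := Metric.mem_closedBall.1 (dyadicCube_subset_closedBall hs _ hx)
        have h4 := dist_triangle x (dyadicCenter s P) (dyadicCenter s P₀)
        have h5 : 0 ≤ A * dyadicSide s P₀.1 := by positivity
        rw [Metric.mem_closedBall]
        linarith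
    _ = _ := by
        rw [Real.volume_pi_closedBall _ (by positivity), Fintype.card_fin, volume_dyadicCube hs,
          ← ENNReal.ofReal_mul (by positivity), ← mul_pow]
        congr 2; ring

lemma abs_dyadicMean_sub_average_le (hs : 0 < s) {ψ : (Fin n → ℝ) → ℝ} (hint : IntegrableOn ψ U)
    (hosc : OscLEOne U ψ) {c : DyadicIndex n} {y : Fin n → ℝ} {r : ℝ} (hr : 0 < r)
    (hyU : Metric.ball y r ⊆ U) (hc : dyadicCube s c ⊆ Metric.ball y r)
    (hle : 2 * r ≤ 46 * dyadicSide s c.1) :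
    |dyadicMean s ψ c - ⨍ x in Metric.ball y r, ψ x| ≤ 46 ^ n := by
  refine abs_average_sub_le (volume_dyadicCube_ne_zero hs c) (volume_dyadicCube_ne_top hs c)
    (hint.mono_set (hc.trans hyU)) (by positivity) ?_
  refine ((lintegral_mono_set hc).trans (hosc y r hr hyU)).trans ?_
  rw [Real.volume_pi_ball _ hr, Fintype.card_fin, volume_dyadicCube hs,
    ← ENNReal.ofReal_mul (by positivity), ← mul_pow]
  gcongr

/-- Both means are compared with the mean over the ball at `x` of radius `d(x)`, the distance to the
complement. It contains both cubes, and `2 d(x) ≤ 34 ℓ(P)`; since `d(x) ≤ 4/3 d(y)`, also `2 d(x) ≤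
136/3 ℓ(Q)`, whence 46. -/
lemma abs_dyadicMean_sub_le (hs : 0 < s) (hbig : ∀ y, Metric.infDist y Uᶜ < 8 * s)
    {ψ : (Fin n → ℝ) → ℝ} (hint : IntegrableOn ψ U) (hosc : OscLEOne U ψ) {P Q : DyadicIndex n}
    (hP : P ∈ whitneyCubes s U) (hQ : Q ∈ whitneyCubes s U) {x y : Fin n → ℝ}
    (hx : x ∈ dyadicCube s P) (hy : y ∈ dyadicCube s Q)
    (hxy : dist x y ≤ 1 / 4 * Metric.infDist x Uᶜ) :
    |dyadicMean s ψ P - dyadicMean s ψ Q| ≤ 2 * 46 ^ n := by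
  have hlP := dyadicSide_pos hs P.1
  have hlQ := dyadicSide_pos hs Q.1
  have h1 := le_infDist_of_mem_whitneyCubes hs hP hx
  have h2 := infDist_le_of_mem_whitneyCubes hs hbig hP hx
  have h3 := le_infDist_of_mem_whitneyCubes hs hQ hy
  have h4 := infDist_le_of_mem_whitneyCubes hs hbig hQ hy
  have h5 := Metric.infDist_le_infDist_add_dist (s := Uᶜ) (x := x) (y := y)
  have h6 := Metric.infDist_le_infDist_add_dist (s := Uᶜ) (x := y) (y := x)
  rw [dist_comm y x] at h6
  have hd : 0 < Metric.infDist x Uᶜ := by linarith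
  have hPb : dyadicCube s P ⊆ Metric.ball x (Metric.infDist x Uᶜ) := by
    intro u hu
    have h7 := Metric.mem_closedBall.1 (dyadicCube_subset_closedBall hs _ hu)
    have h8 := Metric.mem_closedBall'.1 (dyadicCube_subset_closedBall hs _ hx)
    have h9 := dist_triangle u (dyadicCenter s P) x
    rw [Metric.mem_ball]
    linarith
  have hQb : dyadicCube s Q ⊆ Metric.ball x (Metric.infDist x Uᶜ) := by
    intro u hu
    have h7 := Metric.mem_closedBall.1 (dyadicCube_subset_closedBall hs _ hu)
    have h8 := Metric.mem_closedBall'.1 (dyadicCube_subset_closedBall hs _ hy)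
    have h9 := dist_triangle4 u (dyadicCenter s Q) y x
    rw [dist_comm y x] at h9
    rw [Metric.mem_ball]
    linarith
  have hU := ball_infDist_compl_subset U x
  have e1 := abs_dyadicMean_sub_average_le hs hint hosc hd hU hPb (by linarith)
  have e2 := abs_dyadicMean_sub_average_le hs hint hosc hd hU hQb (by linarith)
  rw [abs_sub_comm] at e2
  linarith [abs_sub_le (dyadicMean s ψ P) (⨍ x in Metric.ball x (Metric.infDist x Uᶜ), ψ x)
    (dyadicMean s ψ Q)]

/-- Each point of a chain is replaced by its Whitney cube. The list is chosen before `ψ`; a cube may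
occur in it many times. -/
theorem exists_whitney_chain (hs : 0 < s) (hU : IsOpen U) (hne : Uᶜ.Nonempty)
    (hbig : ∀ y, Metric.infDist y Uᶜ < 8 * s) {x₀ : Fin n → ℝ} {A : ℝ} (hA : 0 ≤ A)
    (hch : ChainCondition U x₀ (1 / 4) A) {Q₀ : DyadicIndex n} (hQ₀ : Q₀ ∈ whitneyCubes s U)
    (hx₀ : x₀ ∈ dyadicCube s Q₀) {Q : DyadicIndex n} (hQ : Q ∈ whitneyCubes s U) :
    ∃ L : List (DyadicIndex n), (∀ P ∈ Q :: L, P ∈ whitneyCubes s U) ∧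
      (Q :: L).Pairwise (DyadicNear s (20 * (1 + A))) ∧ (Q :: L).getLast (by simp) = Q₀ ∧
      ∀ ψ : (Fin n → ℝ) → ℝ, IntegrableOn ψ U → OscLEOne U ψ →
        (Q :: L).IsChain fun P P' => |dyadicMean s ψ P - dyadicMean s ψ P'| ≤ 2 * 46 ^ n := by
  classical
  have h0 : ∀ x, ∃ c, x ∈ U → c ∈ whitneyCubes s U ∧ x ∈ dyadicCube s c := fun x => by
    by_cases hx : x ∈ U
    · obtain ⟨c, hc⟩ := exists_mem_whitneyCubes hs hU hne hx
      exact ⟨c, fun _ => hc⟩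
    · exact ⟨Q, fun h => absurd h hx⟩
  choose wc hwc using h0
  have hQm := dyadicCenter_mem hs Q
  have hQU := dyadicCube_subset_of_mem_whitneyCubes hs hQ hQm
  obtain ⟨L, hLU, hLc, hLp, hLl⟩ := hch _ hQU
  have hQe : wc (dyadicCenter s Q) = Q :=
    eq_of_mem_maximalDyadic (hwc _ hQU).1 hQ (hwc _ hQU).2 hQm
  have hx₀U := dyadicCube_subset_of_mem_whitneyCubes hs hQ₀ hx₀
  have hx₀e : wc x₀ = Q₀ :=
    eq_of_mem_maximalDyadic (hwc _ hx₀U).1 hQ₀ (hwc _ hx₀U).2 hx₀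
  have hmap : Q :: L.map wc = (dyadicCenter s Q :: L).map wc := by rw [List.map_cons, hQe]
  refine ⟨L.map wc, ?_, ?_, ?_, ?_⟩
  · rw [hmap]
    intro P hP
    obtain ⟨y, hy, rfl⟩ := List.mem_map.1 hP
    exact (hwc y (hLU y hy)).1
  · rw [hmap, List.pairwise_map]
    refine hLp.imp_of_mem fun {a b} ha hb hab => ?_
    have h1 := hwc a (hLU a ha)
    have h2 := hwc b (hLU b hb)
    exact dyadicNear_of_dist_le hs hbig hA h1.1 h2.1 h1.2 h2.2 hab
  · simp only [hmap]
    rw [List.getLast_map, hLl, hx₀e]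
  · intro ψ hint hosc
    rw [hmap, List.isChain_map, List.isChain_iff_getElem]
    rw [List.isChain_iff_getElem] at hLc
    intro i hi
    have h1 := hwc _ (hLU _ (List.getElem_mem (Nat.lt_of_succ_lt hi)))
    have h2 := hwc _ (hLU _ (List.getElem_mem hi))
    exact abs_dyadicMean_sub_le hs hbig hint hosc h1.1 h2.1 h1.2 h2.2 (hLc i hi)

end Whitney

/-! ### Integrability over domains with the chain condition -/

lemma tsum_coe_le_of_sum_le {I : Type*} {W : Set I} {h : I → ℝ≥0∞} {B : ℝ≥0∞}
    (H : ∀ F : Finset I, (F : Set I) ⊆ W → ∑ P ∈ F, h P ≤ B) : ∑' c : W, h c ≤ B := by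
  rw [ENNReal.tsum_eq_iSup_sum]
  refine iSup_le fun F => ?_
  have h1 := H (F.map (Function.Embedding.subtype _)) (by
    intro x hx
    obtain ⟨y, -, rfl⟩ := Finset.mem_map.1 (Finset.mem_coe.1 hx)
    exact y.2)
  rwa [Finset.sum_map] at h1

lemma rpow_le_one_add_pow (x : ℝ≥0∞) {q : ℝ} (hq : 0 ≤ q) {m : ℕ} (hm : q ≤ m) :
    x ^ q ≤ 1 + x ^ m := by
  rcases le_total x 1 with h | h
  · exact (ENNReal.rpow_le_one h hq).trans le_self_add
  · refine le_trans ?_ le_add_self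
    rw [← ENNReal.rpow_natCast]
    exact ENNReal.rpow_le_rpow_of_exponent_le h hm

lemma le_one_add_rpow (x : ℝ≥0∞) {p : ℝ} (hp : 1 ≤ p) : x ≤ 1 + x ^ p := by
  rcases le_total x 1 with h | h
  · exact h.trans le_self_add
  · refine le_trans ?_ le_add_self
    simpa using ENNReal.rpow_le_rpow_of_exponent_le h hp

section Core

variable {n : ℕ} {s : ℝ} {U : Set (Fin n → ℝ)} {ψ : (Fin n → ℝ) → ℝ}

lemma sum_lintegral_le_of_whitneyCubes (hs : 0 < s) (g : (Fin n → ℝ) → ℝ≥0∞)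
    (F : Finset (DyadicIndex n)) (hF : (F : Set (DyadicIndex n)) ⊆ whitneyCubes s U) :
    ∑ Q ∈ F, ∫⁻ x in dyadicCube s Q, g x ≤ ∫⁻ x in U, g x := by
  rw [← lintegral_biUnion_finset
    (fun a ha b hb hab => disjoint_of_mem_maximalDyadic (hF ha) (hF hb) hab)
    (fun P _ => measurableSet_dyadicCube hs P)]
  exact lintegral_mono_set (Set.iUnion₂_subset fun P hP =>
    dyadicCube_subset_of_mem_whitneyCubes hs (hF hP))

/-- The cube `Q` lies in the shadow of `Q₀`: a set `G` of Whitney cubes near `Q₀`, of which `Q` is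
near each, joins the two, and the difference of the values of `f` is at most `C` times its
cardinality. -/
def InShadow {n : ℕ} (s : ℝ) (U : Set (Fin n → ℝ)) (A C : ℝ) (f : DyadicIndex n → ℝ)
    (Q₀ Q : DyadicIndex n) : Prop :=
  ∃ G : Finset (DyadicIndex n), (G : Set (DyadicIndex n)) ⊆ whitneyCubes s U ∧
    (∀ P ∈ G, DyadicNear s A Q P ∧ DyadicNear s A P Q₀) ∧ Q ∈ G ∧ |f Q - f Q₀| ≤ C * G.card

/-- In a shadow `|f Q| ≤ M + C N(Q)`, where `N(Q)` counts the cubes near which `Q` lies in the union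
of all the joining sets. The multiplicity estimate bounds the moments of `N` by the volume of that
union, and packing bounds this by `|Q₀|`. Uniformity in `Q₀` is essential, since every stopping cube
will play its part. -/
theorem exists_sum_shadow_le (n m : ℕ) (hm : m ≠ 0) {A : ℝ} (hA : 1 ≤ A) {C : ℝ} (hC : 0 ≤ C)
    {M : ℝ≥0∞} (hM : M ≠ ∞) :
    ∃ K : ℝ≥0∞, K ≠ ∞ ∧ ∀ (s : ℝ) (U : Set (Fin n → ℝ)) (f : DyadicIndex n → ℝ)
      (Q₀ : DyadicIndex n), 0 < s → Q₀ ∈ whitneyCubes s U → ‖f Q₀‖ₑ ≤ M →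
      ∀ F : Finset (DyadicIndex n), (F : Set (DyadicIndex n)) ⊆ whitneyCubes s U →
        (∀ Q ∈ F, InShadow s U A C f Q₀ Q) →
        ∑ Q ∈ F, (1 + ‖f Q‖ₑ ^ m) * volume (dyadicCube s Q) ≤ K * volume (dyadicCube s Q₀) := by
  classical
  obtain ⟨m, rfl⟩ := Nat.exists_eq_succ_of_ne_zero hm
  set κ : ℝ≥0∞ := ENNReal.ofReal ((4 * (2 * A)) ^ n) with hκ
  have hκt : κ ≠ ∞ := ENNReal.ofReal_ne_top
  set c₁ : ℝ≥0∞ := 1 + 2 ^ (m + 1) * (ENNReal.ofReal C ^ (m + 1) + M ^ (m + 1)) with hc₁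
  refine ⟨c₁ * ((m + 1).factorial * κ ^ (m + 1) * κ), ?_, ?_⟩
  · refine ENNReal.mul_ne_top ?_ ?_
    · refine ENNReal.add_ne_top.2 ⟨by simp, ENNReal.mul_ne_top (by simp) ?_⟩
      exact ENNReal.add_ne_top.2
        ⟨ENNReal.pow_ne_top ENNReal.ofReal_ne_top, ENNReal.pow_ne_top hM⟩
    · exact ENNReal.mul_ne_top (ENNReal.mul_ne_top (ENNReal.natCast_ne_top _)
        (ENNReal.pow_ne_top hκt)) hκt
  intro s U f Q₀ hs hQ₀ hf F hF hsh
  have h0 : ∀ Q, ∃ G : Finset (DyadicIndex n), Q ∈ F → (G : Set _) ⊆ whitneyCubes s U ∧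
    (∀ P ∈ G, DyadicNear s A Q P ∧ DyadicNear s A P Q₀) ∧ Q ∈ G ∧
      |f Q - f Q₀| ≤ C * G.card := fun Q => by
    by_cases hQ : Q ∈ F
    · obtain ⟨G, hG⟩ := hsh Q hQ
      exact ⟨G, fun _ => hG⟩
    · exact ⟨∅, fun h => absurd h hQ⟩
  choose G hG using h0
  set H := F.biUnion G with hH
  have hHW : (H : Set _) ⊆ whitneyCubes s U := by
    intro P hP
    obtain ⟨Q, hQ, hPQ⟩ := Finset.mem_biUnion.1 (Finset.mem_coe.1 hP)
    exact (hG Q hQ).1 hPQ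
  have hcount := sum_mul_card_pow_le (w := fun P => volume (dyadicCube s P))
    (l := fun P => dyadicSide s P.1) (W := whitneyCubes s U) (R := DyadicNear s A)
    (R' := DyadicNear s (2 * A)) (K := κ)
    (fun Q P h => h.mono hs (by linarith))
    (fun P₀ _ G hG h => sum_volume_le_of_dyadicNear hs (by linarith) P₀ G hG h)
    (fun Q P P' h h' hle => h.of_common hs hA h' hle) m F H hF hHW
  have hHsum : ∑ P ∈ H, volume (dyadicCube s P) ≤ κ * volume (dyadicCube s Q₀) := by
    refine sum_volume_le_of_dyadicNear hs (by linarith) Q₀ H hHW fun P hP => ?_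
    obtain ⟨Q, hQ, hPQ⟩ := Finset.mem_biUnion.1 hP
    exact ((hG Q hQ).2.1 P hPQ).2.mono hs (by linarith)
  have hpt : ∀ Q ∈ F, (1 + ‖f Q‖ₑ ^ (m + 1)) * volume (dyadicCube s Q) ≤
      c₁ * (volume (dyadicCube s Q) *
        ((H.filter fun P => DyadicNear s A Q P).card : ℝ≥0∞) ^ (m + 1)) := by
    intro Q hQ
    obtain ⟨-, hnear, hself, hfQ⟩ := hG Q hQ
    set N : ℝ≥0∞ := ((H.filter fun P => DyadicNear s A Q P).card : ℝ≥0∞) with hN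
    have hsub : G Q ⊆ H.filter fun P => DyadicNear s A Q P := fun P hP =>
      Finset.mem_filter.2 ⟨Finset.mem_biUnion.2 ⟨Q, hQ, hP⟩, (hnear P hP).1⟩
    have hGN : ((G Q).card : ℝ≥0∞) ≤ N := by
      rw [hN]; exact_mod_cast Finset.card_le_card hsub
    -- Since `Q` belongs to its own joining set, powers of `N` absorb the constants 1 and `M`.
    have hN1 : 1 ≤ N := le_trans (by exact_mod_cast Finset.card_pos.2 ⟨Q, hself⟩) hGN
    have hN1' : 1 ≤ N ^ (m + 1) := one_le_pow₀ hN1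
    have hfd : ‖f Q - f Q₀‖ₑ ≤ ENNReal.ofReal C * N := by
      rw [Real.enorm_eq_ofReal_abs]
      refine (ENNReal.ofReal_le_ofReal hfQ).trans ?_
      rw [ENNReal.ofReal_mul hC, ENNReal.ofReal_natCast]
      gcongr
    have hfb : ‖f Q‖ₑ ^ (m + 1) ≤
        2 ^ (m + 1) * (ENNReal.ofReal C ^ (m + 1) + M ^ (m + 1)) * N ^ (m + 1) := by
      calc ‖f Q‖ₑ ^ (m + 1) ≤ (‖f Q - f Q₀‖ₑ + ‖f Q₀‖ₑ) ^ (m + 1) := by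
            gcongr
            simpa using enorm_add_le (f Q - f Q₀) (f Q₀)
        _ ≤ 2 ^ (m + 1) * (‖f Q - f Q₀‖ₑ ^ (m + 1) + ‖f Q₀‖ₑ ^ (m + 1)) :=
            add_pow_le_two_pow_mul _ _ _
        _ ≤ 2 ^ (m + 1) * ((ENNReal.ofReal C * N) ^ (m + 1) + M ^ (m + 1) * N ^ (m + 1)) := by
            gcongr
            exact (pow_le_pow_left' hf _).trans (le_mul_of_one_le_right zero_le hN1')
        _ = _ := by rw [mul_pow]; ring
    calc (1 + ‖f Q‖ₑ ^ (m + 1)) * volume (dyadicCube s Q)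
        ≤ (N ^ (m + 1) + 2 ^ (m + 1) * (ENNReal.ofReal C ^ (m + 1) + M ^ (m + 1)) *
            N ^ (m + 1)) * volume (dyadicCube s Q) := by gcongr
      _ = _ := by rw [hc₁]; ring
  calc ∑ Q ∈ F, (1 + ‖f Q‖ₑ ^ (m + 1)) * volume (dyadicCube s Q)
      ≤ ∑ Q ∈ F, c₁ * (volume (dyadicCube s Q) *
        ((H.filter fun P => DyadicNear s A Q P).card : ℝ≥0∞) ^ (m + 1)) :=
        Finset.sum_le_sum hpt
    _ ≤ c₁ * ((m + 1).factorial * κ ^ (m + 1) * (κ * volume (dyadicCube s Q₀))) := by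
        rw [← Finset.mul_sum]
        gcongr
        exact hcount.trans (by gcongr)
    _ = _ := by ring

lemma exists_infDist_compl_lt [Nonempty (Fin n)] (hb : Bornology.IsBounded U) :
    Uᶜ.Nonempty ∧ ∃ s : ℝ, 0 < s ∧ ∀ y, Metric.infDist y Uᶜ < 8 * s := by
  have hne : Uᶜ.Nonempty := by
    by_contra hcon
    rw [Set.not_nonempty_iff_eq_empty, Set.compl_empty_iff] at hcon
    rw [hcon] at hb
    exact NormedSpace.unbounded_univ ℝ (Fin n → ℝ) hb
  refine ⟨hne, ?_⟩
  obtain ⟨p, hp⟩ := hne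
  obtain ⟨r, hr⟩ := hb.subset_closedBall p
  refine ⟨|r| + 1, by positivity, fun y => ?_⟩
  by_cases hy : y ∈ U
  · have h1 := Metric.mem_closedBall.1 (hr hy)
    have h2 := Metric.infDist_le_dist_of_mem (x := y) hp
    linarith [le_abs_self r, abs_nonneg r]
  · rw [Metric.infDist_zero_of_mem (show y ∈ Uᶜ from hy)]
    positivity

/-- A shift by `a` leaves differences of means unchanged; both `a = ψ_{Q₀}` and `a = 0` are used. -/
lemma inShadow_center (hs : 0 < s) (hU : IsOpen U) (hne : Uᶜ.Nonempty)
    (hbig : ∀ y, Metric.infDist y Uᶜ < 8 * s) {x₀ : Fin n → ℝ} {A : ℝ} (hA : 0 ≤ A)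
    (hch : ChainCondition U x₀ (1 / 4) A) {Q₀ : DyadicIndex n} (hQ₀ : Q₀ ∈ whitneyCubes s U)
    (hx₀ : x₀ ∈ dyadicCube s Q₀) (hint : IntegrableOn ψ U) (hosc : OscLEOne U ψ) (a : ℝ)
    {Q : DyadicIndex n} (hQ : Q ∈ whitneyCubes s U) :
    InShadow s U (20 * (1 + A)) (2 * 46 ^ n) (fun c => dyadicMean s ψ c - a) Q₀ Q := by
  classical
  obtain ⟨L, hLW, hLp, hLl, hLc⟩ := exists_whitney_chain hs hU hne hbig hA hch hQ₀ hx₀ hQ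
  have hrefl := DyadicNear.refl (n := n) hs (show 1 ≤ 20 * (1 + A) by linarith)
  refine ⟨(Q :: L).toFinset, fun P hP => hLW P (by simpa using hP), fun P hP => ?_, by simp, ?_⟩
  · rw [List.mem_toFinset] at hP
    refine ⟨?_, ?_⟩
    · rcases List.mem_cons.1 hP with rfl | h
      · exact hrefl _
      · exact (List.pairwise_cons.1 hLp).1 P h
    · rw [← hLl]
      exact pairwise_getLast hrefl _ hLp P hP
  · have h1 := abs_sub_getLast_le_card _ (by positivity) _ Q L le_rfl (hLc ψ hint hosc)
    rw [hLl] at h1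
    simp only [sub_sub_sub_cancel_right]
    convert h1

/-- The hypothesis bounds the mean over `U`, the shadow estimate needs the mean over `Q₀`. So the
estimate is applied twice: with exponent 1 to the shifted means, with `M = 0`, it bounds `∫_U |ψ -
ψ_{Q₀}|` and thereby `|ψ_{Q₀}|` by `D + 1`; this then serves as `M` for exponent `m`. -/
theorem exists_lintegral_domain_le [Nonempty (Fin n)] (hU : IsOpen U)
    (hb : Bornology.IsBounded U) {x₀ : Fin n → ℝ} (hx₀ : x₀ ∈ U) {A : ℝ} (hA : 0 ≤ A)
    (hch : ChainCondition U x₀ (1 / 4) A) (m : ℕ) (hm : m ≠ 0) :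
    ∃ K : ℝ≥0∞, K ≠ ∞ ∧ ∀ ψ : (Fin n → ℝ) → ℝ, IntegrableOn ψ U → OscLEOne U ψ →
      |⨍ x in U, ψ x| ≤ 1 → ∫⁻ x in U, ‖ψ x‖ₑ ^ m ≤ K := by
  obtain ⟨hne, s, hs, hbig⟩ := exists_infDist_compl_lt hb
  obtain ⟨Q₀, hQ₀, hxQ₀⟩ := exists_mem_whitneyCubes hs hU hne hx₀
  have hA' : 1 ≤ 20 * (1 + A) := by linarith
  have hU0 : volume U ≠ 0 := (hU.measure_pos volume ⟨x₀, hx₀⟩).ne'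
  have hUt : volume U ≠ ∞ := hb.measure_lt_top.ne
  have hw := volume_dyadicCube_ne_top hs Q₀
  obtain ⟨K₁, hK₁, h₁⟩ := exists_sum_shadow_le n 1 one_ne_zero hA'
    (C := 2 * 46 ^ n) (by positivity) (M := 0) (by simp)
  set D : ℝ := (K₁ * volume (dyadicCube s Q₀) / volume U).toReal with hD
  obtain ⟨K₂, hK₂, h₂⟩ := exists_sum_shadow_le n m hm hA'
    (C := 2 * 46 ^ n) (by positivity) (M := ENNReal.ofReal (D + 1)) ENNReal.ofReal_ne_top
  obtain ⟨K₃, hK₃, h₃⟩ := exists_lintegral_pow_le n m hm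
  refine ⟨K₃ * (K₂ * volume (dyadicCube s Q₀)),
    ENNReal.mul_ne_top hK₃ (ENNReal.mul_ne_top hK₂ hw), fun ψ hint hosc hmean => ?_⟩
  have hsh := fun a Q (hQ : Q ∈ whitneyCubes s U) =>
    inShadow_center hs hU hne hbig hA hch hQ₀ hxQ₀ hint hosc a hQ
  set f₀ := dyadicMean s ψ Q₀ with hf₀
  have hdev : ∫⁻ x in U, ‖ψ x - f₀‖ₑ ≤ K₁ * volume (dyadicCube s Q₀) := by
    rw [lintegral_eq_tsum_whitneyCubes hs hU hne]
    refine tsum_coe_le_of_sum_le (h := fun Q => ∫⁻ x in dyadicCube s Q, ‖ψ x - f₀‖ₑ)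
      fun F hF => le_trans (Finset.sum_le_sum fun Q hQ => ?_)
      (h₁ s U (fun c => dyadicMean s ψ c - f₀) Q₀ hs hQ₀ (by simp [hf₀]) F hF
        fun Q hQ => hsh f₀ Q (hF hQ))
    have hQU := dyadicCube_subset_of_mem_whitneyCubes hs (hF hQ)
    calc ∫⁻ x in dyadicCube s Q, ‖ψ x - f₀‖ₑ
        ≤ ∫⁻ x in dyadicCube s Q, (‖ψ x - dyadicMean s ψ Q‖ₑ + ‖dyadicMean s ψ Q - f₀‖ₑ) := by
          refine lintegral_mono fun x => ?_
          simpa using enorm_add_le (ψ x - dyadicMean s ψ Q) (dyadicMean s ψ Q - f₀)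
      _ ≤ volume (dyadicCube s Q) + ‖dyadicMean s ψ Q - f₀‖ₑ * volume (dyadicCube s Q) := by
          rw [lintegral_add_right' _ aemeasurable_const, setLIntegral_const]
          gcongr
          exact hosc.dyadicCube hs hQU
      _ = _ := by rw [pow_one]; ring
  have hf₀le : |f₀| ≤ D + 1 := by
    have h4 : |(⨍ x in U, ψ x) - f₀| ≤ D := by
      refine abs_average_sub_le hU0 hUt hint ENNReal.toReal_nonneg (hdev.trans (le_of_eq ?_))
      rw [hD, ENNReal.ofReal_toReal
        (ENNReal.div_ne_top (ENNReal.mul_ne_top hK₁ hw) hU0), ENNReal.div_mul_cancel hU0 hUt]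
    have h5 := abs_sub_abs_le_abs_sub f₀ (⨍ x in U, ψ x)
    rw [abs_sub_comm] at h5
    linarith
  rw [lintegral_eq_tsum_whitneyCubes hs hU hne]
  refine tsum_coe_le_of_sum_le (h := fun Q => ∫⁻ x in dyadicCube s Q, ‖ψ x‖ₑ ^ m)
    fun F hF => ?_
  calc ∑ Q ∈ F, ∫⁻ x in dyadicCube s Q, ‖ψ x‖ₑ ^ m
      ≤ ∑ Q ∈ F, K₃ * ((1 + ‖dyadicMean s ψ Q‖ₑ ^ m) * volume (dyadicCube s Q)) := by
        refine Finset.sum_le_sum fun Q hQ => ?_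
        rw [← mul_assoc]
        exact h₃ s U ψ hs hint hosc Q (dyadicCube_subset_of_mem_whitneyCubes hs (hF hQ))
    _ ≤ _ := by
        rw [← Finset.mul_sum]
        gcongr
        refine h₂ s U (dyadicMean s ψ) Q₀ hs hQ₀ ?_ F hF fun Q hQ => ?_
        · rw [Real.enorm_eq_ofReal_abs]
          exact ENNReal.ofReal_le_ofReal hf₀le
        · simpa using hsh 0 Q (hF hQ)

/-! ### Interpolation between BMO and `L^p`. -/

lemma enorm_dyadicMean_le (hs : 0 < s) (hint : IntegrableOn ψ U) {c : DyadicIndex n}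
    (hc : dyadicCube s c ⊆ U) {p : ℝ} (hp : 1 ≤ p) {b : ℝ≥0∞} (hb : b ≠ ∞)
    (h : ∫⁻ x in dyadicCube s c, ‖ψ x‖ₑ ^ p ≤ b * volume (dyadicCube s c)) :
    ‖dyadicMean s ψ c‖ₑ ≤ 1 + b := by
  have h1 : |dyadicMean s ψ c - 0| ≤ (1 + b).toReal := by
    refine abs_average_sub_le (volume_dyadicCube_ne_zero hs c) (volume_dyadicCube_ne_top hs c)
      (hint.mono_set hc) ENNReal.toReal_nonneg ?_
    rw [ENNReal.ofReal_toReal (by simp [hb])]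
    simp only [sub_zero]
    calc ∫⁻ x in dyadicCube s c, ‖ψ x‖ₑ ≤ ∫⁻ x in dyadicCube s c, (1 + ‖ψ x‖ₑ ^ p) :=
          lintegral_mono fun x => le_one_add_rpow _ hp
      _ ≤ _ := by
          rw [lintegral_add_left measurable_const, setLIntegral_const, add_mul]
          gcongr
  rw [sub_zero] at h1
  rw [Real.enorm_eq_ofReal_abs]
  exact ENNReal.ofReal_le_of_le_toReal h1

/-- Decompose `|ψ|^p` at level 1. Off the selected cubes `|ψ| ≤ 1`, so `|ψ|^q ≤ |ψ|^p`. On a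
selected cube `∫|ψ|^q` is at most a multiple of the volume, which is below `∫|ψ|^p`. -/
theorem exists_lintegral_dyadicCube_rpow_le (n : ℕ) {p q : ℝ} (hp : 1 ≤ p) (hpq : p < q) :
    ∃ K : ℝ≥0∞, K ≠ ∞ ∧ ∀ (s : ℝ) (U : Set (Fin n → ℝ)) (ψ : (Fin n → ℝ) → ℝ), 0 < s →
      IntegrableOn ψ U → OscLEOne U ψ → ∀ c : DyadicIndex n, dyadicCube s c ⊆ U →
        ∫⁻ x in dyadicCube s c, ‖ψ x‖ₑ ^ p ≤ volume (dyadicCube s c) →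
        ∫⁻ x in dyadicCube s c, ‖ψ x‖ₑ ^ q ≤ K * ∫⁻ x in dyadicCube s c, ‖ψ x‖ₑ ^ p := by
  set m := ⌈q⌉₊
  have hqm : q ≤ m := Nat.le_ceil q
  have hm : m ≠ 0 := (Nat.ceil_pos.2 (by linarith)).ne'
  obtain ⟨K, hK, hmom⟩ := exists_lintegral_pow_le n m hm
  -- On a selected cube the mean of `|ψ|^p` is at most `2 ^ n`, hence that of `ψ` at most `1 + 2 ^
  -- n` in modulus.
  set B : ℝ≥0∞ := 1 + K * (1 + (1 + 2 ^ n) ^ m) with hB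
  have hBt : B ≠ ∞ := by
    refine ENNReal.add_ne_top.2 ⟨by simp, ENNReal.mul_ne_top hK ?_⟩
    refine ENNReal.add_ne_top.2 ⟨by simp, ENNReal.pow_ne_top ?_⟩
    exact ENNReal.add_ne_top.2 ⟨by simp, by simp⟩
  refine ⟨1 + B, by simp [hBt], ?_⟩
  intro s U ψ hs hint hosc c hc hle
  have hmc := measurableSet_dyadicCube hs c
  have hψm := (hint.mono_set hc).aestronglyMeasurable.enorm
  obtain ⟨T, hdisj, hT, hae⟩ := exists_calderonZygmund hs c (hψm.pow_const p)
    (ne_top_of_le_ne_top (volume_dyadicCube_ne_top hs c) hle) (a := 1) (by rwa [one_mul])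
  set V := ⋃ c' : T, dyadicCube s (c' : DyadicIndex n) with hV
  have hVm : MeasurableSet V := MeasurableSet.iUnion fun c' => measurableSet_dyadicCube hs _
  have hVc : V ⊆ dyadicCube s c := Set.iUnion_subset fun c' => (hT c' c'.2).1
  have hVsum : ∀ g : (Fin n → ℝ) → ℝ≥0∞, ∫⁻ x in V, g x =
      ∑' c' : T, ∫⁻ x in dyadicCube s (c' : DyadicIndex n), g x := fun g =>
    lintegral_iUnion (s := fun c' : T => dyadicCube s (c' : DyadicIndex n))
      (fun c' => measurableSet_dyadicCube hs _)
      (fun a b hab => hdisj a.2 b.2 fun hh => hab (Subtype.ext hh)) g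
  have hin : ∫⁻ x in V, ‖ψ x‖ₑ ^ q ≤ B * ∫⁻ x in V, ‖ψ x‖ₑ ^ p := by
    rw [hVsum, hVsum, ← ENNReal.tsum_mul_left]
    refine ENNReal.tsum_le_tsum fun c' => ?_
    obtain ⟨hsub, hlt, hup⟩ := hT c' c'.2
    rw [one_mul] at hlt
    rw [mul_one] at hup
    have hf := enorm_dyadicMean_le hs hint (hsub.trans hc) hp (by simp) hup
    calc ∫⁻ x in dyadicCube s (c' : DyadicIndex n), ‖ψ x‖ₑ ^ q
        ≤ ∫⁻ x in dyadicCube s (c' : DyadicIndex n), (1 + ‖ψ x‖ₑ ^ m) :=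
          lintegral_mono fun x => rpow_le_one_add_pow _ (by linarith) hqm
      _ ≤ 1 * volume (dyadicCube s (c' : DyadicIndex n)) +
          K * (1 + (1 + 2 ^ n) ^ m) * volume (dyadicCube s (c' : DyadicIndex n)) := by
          rw [lintegral_add_left measurable_const, setLIntegral_const]
          gcongr
          refine (hmom s U ψ hs hint hosc c' (hsub.trans hc)).trans ?_
          gcongr
      _ = B * volume (dyadicCube s (c' : DyadicIndex n)) := by rw [hB]; ring
      _ ≤ _ := by gcongr
  have hout : ∫⁻ x in dyadicCube s c \ V, ‖ψ x‖ₑ ^ q ≤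
      ∫⁻ x in dyadicCube s c \ V, ‖ψ x‖ₑ ^ p := by
    refine lintegral_mono_ae ?_
    rw [ae_restrict_iff' hmc] at hae
    rw [ae_restrict_iff' (hmc.diff hVm)]
    filter_upwards [hae] with x hx hxV
    have h1 := hx hxV.1 fun c' hc' hxc' => hxV.2 (Set.mem_iUnion.2 ⟨⟨c', hc'⟩, hxc'⟩)
    have h2 : ‖ψ x‖ₑ ≤ 1 := by
      by_contra hcon
      exact absurd h1 (not_le.2 (ENNReal.one_lt_rpow (not_le.1 hcon) (by linarith)))
    exact ENNReal.rpow_le_rpow_of_exponent_ge h2 hpq.le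
  calc ∫⁻ x in dyadicCube s c, ‖ψ x‖ₑ ^ q
      = (∫⁻ x in V, ‖ψ x‖ₑ ^ q) + ∫⁻ x in dyadicCube s c \ V, ‖ψ x‖ₑ ^ q := by
        rw [← lintegral_inter_add_sdiff _ (dyadicCube s c) hVm,
          Set.inter_eq_self_of_subset_right hVc]
    _ ≤ (B * ∫⁻ x in dyadicCube s c, ‖ψ x‖ₑ ^ p) + ∫⁻ x in dyadicCube s c, ‖ψ x‖ₑ ^ p := by
        refine add_le_add (hin.trans ?_) (hout.trans (lintegral_mono_set Set.sdiff_subset))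
        gcongr
    _ = _ := by ring

theorem exists_lintegral_domain_rpow_le [Nonempty (Fin n)] (hU : IsOpen U)
    (hb : Bornology.IsBounded U) {x₀ : Fin n → ℝ} (hx₀ : x₀ ∈ U) {A : ℝ} (hA : 0 ≤ A)
    (hch : ChainCondition U x₀ (1 / 4) A) {p q : ℝ} (hp : 1 ≤ p) (hpq : p < q) :
    ∃ K : ℝ≥0∞, K ≠ ∞ ∧ ∀ ψ : (Fin n → ℝ) → ℝ, IntegrableOn ψ U → OscLEOne U ψ →
      |⨍ x in U, ψ x| ≤ 1 → ∫⁻ x in U, ‖ψ x‖ₑ ^ q ≤ K * ∫⁻ x in U, ‖ψ x‖ₑ ^ p := by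
  classical
  obtain ⟨hne, s, hs, hbig⟩ := exists_infDist_compl_lt hb
  obtain ⟨Q₀, hQ₀, hxQ₀⟩ := exists_mem_whitneyCubes hs hU hne hx₀
  have hA' : 1 ≤ 20 * (1 + A) := by linarith
  have hUt : volume U ≠ ∞ := hb.measure_lt_top.ne
  have hw0 := volume_dyadicCube_ne_zero hs Q₀
  have hwt := volume_dyadicCube_ne_top hs Q₀
  set m := ⌈q⌉₊
  have hqm : q ≤ m := Nat.le_ceil q
  have hm : m ≠ 0 := (Nat.ceil_pos.2 (by linarith)).ne'
  obtain ⟨K₁, hK₁, h₁⟩ := exists_lintegral_domain_le hU hb hx₀ hA hch m hm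
  obtain ⟨K₂, hK₂, h₂⟩ := exists_lintegral_dyadicCube_rpow_le n hp hpq
  obtain ⟨K₃, hK₃, h₃⟩ := exists_sum_shadow_le n m hm hA' (C := 2 * 46 ^ n) (by positivity)
    (M := ENNReal.ofReal (2 * 46 ^ n) + 2)
    (ENNReal.add_ne_top.2 ⟨ENNReal.ofReal_ne_top, by simp⟩)
  obtain ⟨K₄, hK₄, h₄⟩ := exists_lintegral_pow_le n m hm
  have hpow : ∀ (ψ : (Fin n → ℝ) → ℝ) (E : Set (Fin n → ℝ)), ∫⁻ x in E, ‖ψ x‖ₑ ^ q ≤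
      volume E + ∫⁻ x in E, ‖ψ x‖ₑ ^ m := fun ψ E => by
    calc ∫⁻ x in E, ‖ψ x‖ₑ ^ q ≤ ∫⁻ x in E, (1 + ‖ψ x‖ₑ ^ m) :=
          lintegral_mono fun x => rpow_le_one_add_pow _ (by linarith) hqm
      _ = _ := by rw [lintegral_add_left measurable_const, setLIntegral_const, one_mul]
  refine ⟨(volume U + K₁) / volume (dyadicCube s Q₀) + (K₂ + (1 + K₄) * K₃), ?_, ?_⟩
  · refine ENNReal.add_ne_top.2 ⟨ENNReal.div_ne_top (ENNReal.add_ne_top.2 ⟨hUt, hK₁⟩) hw0, ?_⟩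
    refine ENNReal.add_ne_top.2 ⟨hK₂, ENNReal.mul_ne_top ?_ hK₃⟩
    exact ENNReal.add_ne_top.2 ⟨by simp, hK₄⟩
  intro ψ hint hosc hmean
  set I : ℝ≥0∞ := ∫⁻ x in U, ‖ψ x‖ₑ ^ p with hI
  set Bd : DyadicIndex n → Prop := fun Q =>
    volume (dyadicCube s Q) < ∫⁻ x in dyadicCube s Q, ‖ψ x‖ₑ ^ p with hBd
  -- If the central cube is bad, `|Q₀| ≤ ∫_U |ψ|^p` turns an absolute bound of `∫|ψ|^q` into the
  -- required one. Otherwise every chain from a bad cube meets a good one.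
  by_cases hQ₀b : Bd Q₀
  · have h5 : volume (dyadicCube s Q₀) ≤ I :=
      hQ₀b.le.trans (lintegral_mono_set (dyadicCube_subset_of_mem_whitneyCubes hs hQ₀))
    calc ∫⁻ x in U, ‖ψ x‖ₑ ^ q ≤ volume U + K₁ :=
          (hpow ψ U).trans (by gcongr; exact h₁ ψ hint hosc hmean)
      _ = (volume U + K₁) / volume (dyadicCube s Q₀) * volume (dyadicCube s Q₀) := by
          rw [ENNReal.div_mul_cancel hw0 hwt]
      _ ≤ _ := by gcongr; exact le_self_add
  · have hselect : ∀ Q, ∃ q', Q ∈ whitneyCubes s U → Bd Q → q' ∈ whitneyCubes s U ∧ Bd q' ∧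
        ‖dyadicMean s ψ q'‖ₑ ≤ ENNReal.ofReal (2 * 46 ^ n) + 2 ∧
        InShadow s U (20 * (1 + A)) (2 * 46 ^ n) (dyadicMean s ψ) q' Q := by
      intro Q
      by_cases hQ : Q ∈ whitneyCubes s U ∧ Bd Q
      swap
      · exact ⟨Q, fun h h' => absurd ⟨h, h'⟩ hQ⟩
      obtain ⟨L, hLW, hLp, hLl, hLc⟩ :=
        exists_whitney_chain hs hU hne hbig hA hch hQ₀ hxQ₀ hQ.1
      obtain ⟨q', hq', g, hg, hq'b, hgb, hqg, G, hG, hQG, hfG⟩ :=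
        exists_stopped_chain (by positivity) (DyadicNear.refl hs hA') Bd (hLc ψ hint hosc) hLp hQ.2
          (by rwa [hLl])
      refine ⟨q', fun _ _ => ⟨hLW _ hq', hq'b, ?_, G, fun P hP => hLW P (hG P hP).1,
        fun P hP => (hG P hP).2, hQG, hfG⟩⟩
      have h6 := enorm_dyadicMean_le hs hint (dyadicCube_subset_of_mem_whitneyCubes hs (hLW _ hg))
        hp (b := 1) (by simp) (by rw [one_mul]; exact not_lt.1 hgb)
      rw [one_add_one_eq_two] at h6
      calc ‖dyadicMean s ψ q'‖ₑ
          ≤ ‖dyadicMean s ψ q' - dyadicMean s ψ g‖ₑ + ‖dyadicMean s ψ g‖ₑ := by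
            simpa using enorm_add_le (dyadicMean s ψ q' - dyadicMean s ψ g) (dyadicMean s ψ g)
        _ ≤ _ := by
            gcongr
            rw [Real.enorm_eq_ofReal_abs]
            exact ENNReal.ofReal_le_ofReal hqg
    choose σ hσ using hselect
    have hgood : ∀ F : Finset (DyadicIndex n), (F : Set _) ⊆ whitneyCubes s U →
        ∑ Q ∈ F.filter (fun Q => ¬ Bd Q), ∫⁻ x in dyadicCube s Q, ‖ψ x‖ₑ ^ q ≤ K₂ * I := by
      intro F hF
      have hF' : ((F.filter fun Q => ¬ Bd Q : Finset _) : Set _) ⊆ whitneyCubes s U :=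
        fun Q hQ => hF (Finset.mem_filter.1 hQ).1
      calc ∑ Q ∈ F.filter (fun Q => ¬ Bd Q), ∫⁻ x in dyadicCube s Q, ‖ψ x‖ₑ ^ q
          ≤ ∑ Q ∈ F.filter (fun Q => ¬ Bd Q), K₂ * ∫⁻ x in dyadicCube s Q, ‖ψ x‖ₑ ^ p :=
            Finset.sum_le_sum fun Q hQ => h₂ s U ψ hs hint hosc Q
              (dyadicCube_subset_of_mem_whitneyCubes hs (hF' hQ))
              (not_lt.1 (Finset.mem_filter.1 hQ).2)
        _ ≤ K₂ * I := by
            rw [← Finset.mul_sum]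
            gcongr
            exact sum_lintegral_le_of_whitneyCubes hs _ _ hF'
    have hbad : ∀ F : Finset (DyadicIndex n), (F : Set _) ⊆ whitneyCubes s U →
        ∑ Q ∈ F.filter Bd, ∫⁻ x in dyadicCube s Q, ‖ψ x‖ₑ ^ q ≤ (1 + K₄) * K₃ * I := by
      intro F hF
      have hσF : ∀ Q ∈ F.filter Bd, _ := fun Q hQ =>
        hσ Q (hF (Finset.mem_filter.1 hQ).1) (Finset.mem_filter.1 hQ).2
      -- Bad cubes are grouped by their stopping cube, and each stopping cube occurs once in `H`.
      set H := (F.filter Bd).image σ with hH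
      have hHσ : ∀ P ∈ H, P ∈ whitneyCubes s U ∧ Bd P ∧
          ‖dyadicMean s ψ P‖ₑ ≤ ENNReal.ofReal (2 * 46 ^ n) + 2 := by
        intro P hP
        obtain ⟨Q, hQ, rfl⟩ := Finset.mem_image.1 hP
        exact ⟨(hσF Q hQ).1, (hσF Q hQ).2.1, (hσF Q hQ).2.2.1⟩
      calc ∑ Q ∈ F.filter Bd, ∫⁻ x in dyadicCube s Q, ‖ψ x‖ₑ ^ q
          ≤ ∑ Q ∈ F.filter Bd,
              (1 + K₄) * ((1 + ‖dyadicMean s ψ Q‖ₑ ^ m) * volume (dyadicCube s Q)) := by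
            refine Finset.sum_le_sum fun Q hQ => (hpow ψ _).trans ?_
            have h7 := h₄ s U ψ hs hint hosc Q
              (dyadicCube_subset_of_mem_whitneyCubes hs (hF (Finset.mem_filter.1 hQ).1))
            rw [add_mul, one_mul, ← mul_assoc K₄]
            refine add_le_add ?_ h7
            exact le_mul_of_one_le_left zero_le le_self_add
        _ = (1 + K₄) * ∑ P ∈ H, ∑ Q ∈ (F.filter Bd).filter (fun Q => σ Q = P),
              (1 + ‖dyadicMean s ψ Q‖ₑ ^ m) * volume (dyadicCube s Q) := by
            rw [← Finset.mul_sum, Finset.sum_fiberwise_of_maps_to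
              fun Q hQ => Finset.mem_image_of_mem σ hQ]
        _ ≤ (1 + K₄) * ∑ P ∈ H, K₃ * ∫⁻ x in dyadicCube s P, ‖ψ x‖ₑ ^ p := by
            gcongr with P hP
            obtain ⟨hPW, hPb, hPf⟩ := hHσ P hP
            refine (h₃ s U (dyadicMean s ψ) P hs hPW hPf _ ?_ ?_).trans ?_
            · exact fun Q hQ => hF (Finset.mem_filter.1 (Finset.mem_filter.1 hQ).1).1
            · intro Q hQ
              obtain ⟨hQ1, rfl⟩ := Finset.mem_filter.1 hQ
              exact (hσF Q hQ1).2.2.2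
            -- Badness of the stopping cube turns its volume into `∫ |ψ|^p`.
            · gcongr
        _ ≤ (1 + K₄) * (K₃ * I) := by
            rw [← Finset.mul_sum]
            gcongr
            exact sum_lintegral_le_of_whitneyCubes hs _ _ fun P hP => (hHσ P hP).1
        _ = _ := by ring
    rw [lintegral_eq_tsum_whitneyCubes hs hU hne]
    refine (tsum_coe_le_of_sum_le (h := fun Q => ∫⁻ x in dyadicCube s Q, ‖ψ x‖ₑ ^ q)
      (B := (K₂ + (1 + K₄) * K₃) * I) fun F hF => ?_).trans ?_
    · rw [← Finset.sum_filter_add_sum_filter_not F Bd, add_comm, add_mul]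
      exact add_le_add (hgood F hF) (hbad F hF)
    · exact mul_le_mul' le_add_self le_rfl

end Core

/-! ### John and Lipschitz domains satisfy the chain condition -/

section Chains

variable {X : Type*} [PseudoMetricSpace X] {U : Set X}

lemma infDist_compl_pos (hU : IsOpen U) (hne : Uᶜ.Nonempty) {x : X} (hx : x ∈ U) :
    0 < Metric.infDist x Uᶜ :=
  (hU.isClosed_compl.notMem_iff_infDist_pos hne).1 (by simpa using hx)

lemma exists_infDist_compl_ge (hU : IsOpen U) (hne : Uᶜ.Nonempty) {γ : ℝ → X} {L : ℝ}
    (hL : 0 ≤ L) (hγ : ContinuousOn γ (Set.Icc 0 L)) (hγU : ∀ t ∈ Set.Icc 0 L, γ t ∈ U) :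
    ∃ η > 0, ∀ t ∈ Set.Icc 0 L, η ≤ Metric.infDist (γ t) Uᶜ := by
  obtain ⟨t₀, ht₀, hmin⟩ := isCompact_Icc.exists_isMinOn (Set.nonempty_Icc.2 hL)
    ((Metric.continuous_infDist_pt Uᶜ).comp_continuousOn hγ)
  exact ⟨_, infDist_compl_pos hU hne (hγU t₀ ht₀), fun t ht => hmin ht⟩

/-- The distance to the complement has a positive minimum on the path, so by uniform continuity a
fine equipartition works. The ordered parameters are kept so that distances to earlier points can be
compared later. -/
theorem exists_chain_of_path (hU : IsOpen U) (hne : Uᶜ.Nonempty) {γ : ℝ → X} {L : ℝ}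
    (hL : 0 ≤ L) (hγ : ContinuousOn γ (Set.Icc 0 L)) (hγU : ∀ t ∈ Set.Icc 0 L, γ t ∈ U)
    {ε : ℝ} (hε : 0 < ε) :
    ∃ l : List X, (γ 0 :: l).IsChain (fun y z => dist y z ≤ ε * Metric.infDist y Uᶜ) ∧
      (∀ y ∈ γ 0 :: l, ∃ t ∈ Set.Icc 0 L, γ t = y) ∧
      (γ 0 :: l).Pairwise (fun y z => ∃ a b, 0 ≤ a ∧ a ≤ b ∧ b ≤ L ∧ γ a = y ∧ γ b = z) ∧
      (γ 0 :: l).getLast (by simp) = γ L := by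
  obtain ⟨η, hη, hηγ⟩ := exists_infDist_compl_ge hU hne hL hγ hγU
  obtain ⟨δ, hδ, huc⟩ := Metric.uniformContinuousOn_iff.1
    (isCompact_Icc.uniformContinuousOn_of_continuous hγ) (ε * η) (by positivity)
  obtain ⟨N, hN⟩ := exists_nat_gt (L / δ)
  have hN0 : (0 : ℝ) < N := lt_of_le_of_lt (by positivity) hN
  have hstep : L / N < δ := by
    rw [div_lt_iff₀ hδ] at hN
    rw [div_lt_iff₀ hN0]; linarith
  set τ : ℕ → ℝ := fun i => i * (L / N) with hτ
  have hτ0 : ∀ i, 0 ≤ τ i := fun i => by positivity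
  have hτmono : ∀ i j, i ≤ j → τ i ≤ τ j := fun i j hij => by
    simp only [hτ]; gcongr
  have hτN : τ N = L := by simp only [hτ]; field_simp
  have hτL : ∀ i ≤ N, τ i ∈ Set.Icc 0 L := fun i hi => ⟨hτ0 i, hτN ▸ hτmono i N hi⟩
  have heq : γ 0 :: (List.range N).map (fun i => γ (τ (i + 1))) =
      (List.range (N + 1)).map fun i => γ (τ i) := by
    rw [List.range_succ_eq_map, List.map_cons, List.map_map]
    simp [hτ, Function.comp_def]
  refine ⟨(List.range N).map fun i => γ (τ (i + 1)), ?_, ?_, ?_, ?_⟩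
  · rw [heq, List.isChain_map, List.isChain_range_succ]
    intro i hi
    have h1 := huc (τ i) (hτL i hi.le) (τ (i + 1)) (hτL (i + 1) hi) (by
      rw [dist_comm, Real.dist_eq]
      have : τ (i + 1) - τ i = L / N := by simp only [hτ]; push_cast; ring
      rw [this, abs_of_nonneg (by positivity)]
      exact hstep)
    refine h1.le.trans ?_
    gcongr
    exact hηγ _ (hτL i hi.le)
  · rw [heq]
    intro y hy
    obtain ⟨i, hi, rfl⟩ := List.mem_map.1 hy
    exact ⟨τ i, hτL i (Nat.lt_succ_iff.1 (List.mem_range.1 hi)), rfl⟩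
  · rw [heq, List.pairwise_map]
    refine List.pairwise_lt_range.imp_of_mem fun {i j} _ hj hij => ?_
    exact ⟨τ i, τ j, hτ0 i, hτmono i j hij.le, (hτL j (Nat.lt_succ_iff.1 (List.mem_range.1 hj))).2,
      rfl, rfl⟩
  · simp only [heq, List.range_succ, List.map_append, List.map_cons, List.map_nil,
      List.getLast_append_singleton, hτN]

/-- From every point of `S ∩ U` a chain leads to points at distance at least `η` from the
complement. -/
def EscapeChains (U S : Set X) (ε A η : ℝ) : Prop :=
  ∀ x ∈ S ∩ U, ∃ l : List X, (∀ y ∈ x :: l, y ∈ U) ∧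
    (x :: l).IsChain (fun y z => dist y z ≤ ε * Metric.infDist y Uᶜ) ∧
    (x :: l).Pairwise (fun y z => dist y z ≤ A * Metric.infDist z Uᶜ) ∧
    η ≤ Metric.infDist ((x :: l).getLast (by simp)) Uᶜ

lemma EscapeChains.mono {S S' : Set X} {ε A A' η η' : ℝ} (h : EscapeChains U S ε A η)
    (hS : S' ⊆ S) (hA : A ≤ A') (hη : η' ≤ η) : EscapeChains U S' ε A' η' := by
  intro x hx
  obtain ⟨l, h1, h2, h3, h4⟩ := h x ⟨hS hx.1, hx.2⟩
  refine ⟨l, h1, h2, h3.imp fun {y z} hyz => hyz.trans ?_, hη.trans h4⟩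
  have := Metric.infDist_nonneg (x := z) (s := Uᶜ)
  gcongr

/-- The property passes to subsets and finite unions, at the price of a larger `A` and a smaller
`η`. -/
theorem exists_escapeChains_of_local {K : Set X} (hK : IsCompact K) {ε : ℝ}
    (h : ∀ x ∈ K, ∃ t ∈ nhds x, ∃ A η : ℝ, 0 < η ∧ EscapeChains U t ε A η) :
    ∃ A η : ℝ, 0 < η ∧ EscapeChains U K ε A η := by
  refine hK.induction_on (p := fun S => ∃ A η : ℝ, 0 < η ∧ EscapeChains U S ε A η) ?_ ?_ ?_ ?_
  · exact ⟨0, 1, one_pos, fun x hx => absurd hx.1 (Set.notMem_empty x)⟩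
  · rintro s t hst ⟨A, η, hη, h⟩
    exact ⟨A, η, hη, h.mono hst le_rfl le_rfl⟩
  · rintro s t ⟨A, η, hη, h⟩ ⟨A', η', hη', h'⟩
    refine ⟨max A A', min η η', lt_min hη hη', ?_⟩
    rintro x ⟨hx | hx, hxU⟩
    · exact h.mono subset_rfl (le_max_left A A') (min_le_left _ _) x ⟨hx, hxU⟩
    · exact h'.mono subset_rfl (le_max_right A A') (min_le_right _ _) x ⟨hx, hxU⟩
  · intro x hx
    obtain ⟨t, ht, h⟩ := h x hx
    exact ⟨t, mem_nhdsWithin_of_mem_nhds ht, h⟩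

lemma exists_escapeChains_of_mem (hU : IsOpen U) (hne : Uᶜ.Nonempty) {x : X} (hx : x ∈ U)
    (ε : ℝ) : ∃ t ∈ nhds x, ∃ A η : ℝ, 0 < η ∧ EscapeChains U t ε A η := by
  have hd := infDist_compl_pos hU hne hx
  refine ⟨_, Metric.ball_mem_nhds x (half_pos hd), 0, _, half_pos hd, fun y hy => ⟨[], ?_⟩⟩
  have h1 := Metric.infDist_le_infDist_add_dist (s := Uᶜ) (x := x) (y := y)
  have h2 := Metric.mem_ball'.1 hy.1
  refine ⟨by simpa using hy.2, by simp, by simp, ?_⟩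
  simp only [List.getLast_singleton]
  linarith

end Chains

/-! ### John domains. -/

lemma dist_le_of_hasUnitSpeedOn {E : Type*} [PseudoMetricSpace E] {γ : ℝ → E} {s : Set ℝ}
    (h : HasUnitSpeedOn γ s) {a b : ℝ} (ha : a ∈ s) (hb : b ∈ s) (hab : a ≤ b) :
    dist (γ a) (γ b) ≤ b - a := by
  have h1 := h ha hb
  have h2 := eVariationOn.edist_le γ (s := s ∩ Set.Icc a b) (x := a) (y := b)
    ⟨ha, le_rfl, hab⟩ ⟨hb, hab, le_rfl⟩
  rw [h1, edist_dist, NNReal.coe_one, one_mul,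
    ENNReal.ofReal_le_ofReal_iff (sub_nonneg.2 hab)] at h2
  exact h2

lemma le_infDist_compl_of_ball_subset {X : Type*} [PseudoMetricSpace X] {U : Set X}
    (hne : Uᶜ.Nonempty) {x : X} {r : ℝ} (h : Metric.ball x r ⊆ U) :
    r ≤ Metric.infDist x Uᶜ := by
  rw [Metric.le_infDist hne]
  intro y hy
  by_contra hcon
  exact hy (h (Metric.mem_ball'.2 (not_le.1 hcon)))

/-- For parameters `a ≤ b`, `|γ(a) - γ(b)| ≤ b - a ≤ b`, which is at most `α` times the distance of
`γ(b)` to the complement. -/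
theorem IsJohnDomain.exists_chainCondition {n : ℕ} {U : Set (EuclideanSpace ℝ (Fin n))}
    (h : IsJohnDomain U) (hne : Uᶜ.Nonempty) {ε : ℝ} (hε : 0 < ε) :
    ∃ x₀ ∈ U, ∃ A, 0 ≤ A ∧ ChainCondition U x₀ ε A := by
  obtain ⟨⟨hU, -, -⟩, x₀, hx₀, α, hα, hpath⟩ := h
  refine ⟨x₀, hx₀, α, hα.le, fun x hx => ?_⟩
  obtain ⟨L, γ, hL, hspeed, rfl, rfl, hγ⟩ := hpath x hx
  have hdist : ∀ a b, 0 ≤ a → a ≤ b → b ≤ L → dist (γ a) (γ b) ≤ b - a :=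
    fun a b ha hab hb => dist_le_of_hasUnitSpeedOn hspeed ⟨ha, hab.trans hb⟩ ⟨ha.trans hab, hb⟩ hab
  have hcont : ContinuousOn γ (Set.Icc 0 L) := by
    have : LipschitzOnWith 1 γ (Set.Icc 0 L) := LipschitzOnWith.of_dist_le_mul fun a ha b hb => by
      rw [NNReal.coe_one, one_mul, Real.dist_eq]
      rcases le_total a b with hab | hab
      · rw [abs_sub_comm]; exact (hdist a b ha.1 hab hb.2).trans (le_abs_self _)
      · rw [dist_comm]; exact (hdist b a hb.1 hab ha.2).trans (le_abs_self _)
    exact this.continuousOn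
  obtain ⟨l, h1, h2, h3, h4⟩ :=
    exists_chain_of_path hU hne hL hcont (fun t ht => (hγ t ht).1) hε
  refine ⟨l, fun y hy => ?_, h1, h3.imp ?_, h4⟩
  · obtain ⟨t, ht, rfl⟩ := h2 y hy
    exact (hγ t ht).1
  · rintro y z ⟨a, b, ha, hab, hb, rfl, rfl⟩
    have h5 := le_infDist_compl_of_ball_subset hne (hγ b ⟨ha.trans hab, hb⟩).2
    rw [div_le_iff₀ hα] at h5
    linarith [hdist a b ha hab hb]

/-! ### Interior chains and Lipschitz domains. -/

section Interior

variable {E : Type*} [NormedAddCommGroup E] [NormedSpace ℝ E] {U : Set E}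

lemma exists_interior_chain (hU : IsOpen U) (hc : IsConnected U) (hne : Uᶜ.Nonempty) {x x₀ : E}
    (hx : x ∈ U) (hx₀ : x₀ ∈ U) {ε : ℝ} (hε : 0 < ε) :
    ∃ η > 0, ∃ l : List E, (∀ y ∈ x :: l, y ∈ U ∧ η ≤ Metric.infDist y Uᶜ) ∧
      (x :: l).IsChain (fun y z => dist y z ≤ ε * Metric.infDist y Uᶜ) ∧
      (x :: l).getLast (by simp) = x₀ := by
  obtain ⟨γ, hγ⟩ := ((hU.isConnected_iff_isPathConnected).1 hc).joinedIn x hx x₀ hx₀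
  have hγU : ∀ t ∈ Set.Icc (0 : ℝ) 1, γ.extend t ∈ U := fun t ht => by
    rw [γ.extend_apply ht]; exact hγ _
  have hcont : ContinuousOn γ.extend (Set.Icc 0 1) := γ.extend.continuous.continuousOn
  obtain ⟨η, hη, hηγ⟩ := exists_infDist_compl_ge hU hne zero_le_one hcont hγU
  obtain ⟨l, h1, h2, h3, h4⟩ := exists_chain_of_path hU hne zero_le_one hcont hγU hε
  simp only [Path.extend_zero, Path.extend_one] at h1 h2 h3 h4
  refine ⟨η, hη, l, fun y hy => ?_, h1, h4⟩
  obtain ⟨t, ht, rfl⟩ := h2 y hy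
  exact ⟨hγU t ht, hηγ t ht⟩

/-- The chain from `z` serves all points near `z` after one more step, so finitely many chains give
a common `η`. -/
lemma exists_interior_chain_of_isCompact (hU : IsOpen U) (hc : IsConnected U) (hne : Uᶜ.Nonempty)
    {x₀ : E} (hx₀ : x₀ ∈ U) {ε : ℝ} (hε : 0 < ε) {K : Set E} (hK : IsCompact K) (hKU : K ⊆ U) :
    ∃ η > 0, ∀ x ∈ K, ∃ l : List E, (∀ y ∈ x :: l, y ∈ U ∧ η ≤ Metric.infDist y Uᶜ) ∧
      (x :: l).IsChain (fun y z => dist y z ≤ ε * Metric.infDist y Uᶜ) ∧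
      (x :: l).getLast (by simp) = x₀ := by
  refine hK.induction_on ⟨1, one_pos, by simp⟩ ?_ ?_ ?_
  · rintro s t hst ⟨η, hη, h⟩
    exact ⟨η, hη, fun x hx => h x (hst hx)⟩
  · rintro s t ⟨η, hη, h⟩ ⟨η', hη', h'⟩
    refine ⟨min η η', lt_min hη hη', ?_⟩
    rintro x (hx | hx)
    · obtain ⟨l, h1, h2⟩ := h x hx
      exact ⟨l, fun y hy => ⟨(h1 y hy).1, (min_le_left _ _).trans (h1 y hy).2⟩, h2⟩
    · obtain ⟨l, h1, h2⟩ := h' x hx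
      exact ⟨l, fun y hy => ⟨(h1 y hy).1, (min_le_right _ _).trans (h1 y hy).2⟩, h2⟩
  · intro z hz
    obtain ⟨η, hη, l, h1, h2, h3⟩ := exists_interior_chain hU hc hne (hKU hz) hx₀ hε
    have hd := infDist_compl_pos hU hne (hKU hz)
    set d := Metric.infDist z Uᶜ
    refine ⟨_, mem_nhdsWithin_of_mem_nhds (Metric.ball_mem_nhds z
      (show 0 < min (d / 2) (ε * (d / 2)) by positivity)), min η (d / 2), by positivity,
      fun x hx => ?_⟩
    rw [Metric.mem_ball, lt_min_iff] at hx
    have hdx : d / 2 ≤ Metric.infDist x Uᶜ := by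
      have := Metric.infDist_le_infDist_add_dist (s := Uᶜ) (x := z) (y := x)
      rw [dist_comm] at this
      linarith [hx.1]
    refine ⟨z :: l, ?_, ?_, ?_⟩
    · intro y hy
      rcases List.mem_cons.1 hy with rfl | hy
      · refine ⟨ball_infDist_compl_subset U _ (Metric.mem_ball_self (by linarith)), ?_⟩
        exact (min_le_right _ _).trans hdx
      · exact ⟨(h1 y hy).1, (min_le_left _ _).trans (h1 y hy).2⟩
    · rw [List.isChain_cons_cons]
      refine ⟨hx.2.le.trans ?_, h2⟩
      gcongr
    · rw [List.getLast_cons (by simp), h3]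

/-- An escape chain ends in a compact subset of `U`, from which interior chains stay `η'` away from
the complement. There the crude bound by the diameter `D` suffices, whence `D / η'`. -/
theorem chainCondition_of_escapeChains [ProperSpace E] (hU : IsOpen U) (hc : IsConnected U)
    (hb : Bornology.IsBounded U) (hne : Uᶜ.Nonempty) {x₀ : E} (hx₀ : x₀ ∈ U) {ε A η : ℝ}
    (hε : 0 < ε) (hη : 0 < η) (h : EscapeChains U U ε A η) :
    ∃ A', 0 ≤ A' ∧ ChainCondition U x₀ ε A' := by
  set K := closure U ∩ {x | η ≤ Metric.infDist x Uᶜ} with hKdef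
  have hK : IsCompact K := (hb.isCompact_closure).inter_right
    (isClosed_le continuous_const (Metric.continuous_infDist_pt Uᶜ))
  have hKU : K ⊆ U := fun x hx =>
    ball_infDist_compl_subset U x (Metric.mem_ball_self (hη.trans_le hx.2))
  obtain ⟨η', hη', hint⟩ := exists_interior_chain_of_isCompact hU hc hne hx₀ hε hK hKU
  obtain ⟨D, hD⟩ := Metric.isBounded_iff.1 hb
  have hD0 : 0 ≤ D := dist_self x₀ ▸ hD hx₀ hx₀
  refine ⟨max A (D / η'), le_max_of_le_right (by positivity), fun x hx => ?_⟩
  obtain ⟨l₁, h1, h2, h3, h4⟩ := h x ⟨hx, hx⟩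
  set z := (x :: l₁).getLast (by simp) with hz
  have hzU : z ∈ U := h1 z (List.getLast_mem _)
  obtain ⟨l₂, g1, g2, g3⟩ := hint z ⟨subset_closure hzU, h4⟩
  have hfar : ∀ y ∈ U, ∀ w ∈ l₂, dist y w ≤ max A (D / η') * Metric.infDist w Uᶜ := by
    intro y hy w hw
    obtain ⟨hwU, hwη⟩ := g1 w (List.mem_cons_of_mem z hw)
    calc dist y w ≤ D := hD hy hwU
      _ = D / η' * η' := by field_simp
      _ ≤ _ := by gcongr; exact le_max_right _ _
  have hcat : x :: (l₁ ++ l₂) = (x :: l₁) ++ l₂ := rfl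
  refine ⟨l₁ ++ l₂, ?_, ?_, ?_, ?_⟩
  · rw [hcat]
    intro y hy
    rcases List.mem_append.1 hy with hy | hy
    · exact h1 y hy
    · exact (g1 y (List.mem_cons_of_mem z hy)).1
  · rw [hcat, List.isChain_append]
    rw [List.isChain_cons] at g2
    refine ⟨h2, g2.2, fun a ha b hb => ?_⟩
    rw [List.getLast?_eq_getLast_of_ne_nil (by simp), Option.mem_some_iff] at ha
    rw [← ha]
    exact g2.1 b hb
  · rw [hcat, List.pairwise_append]
    refine ⟨h3.imp fun {y w} hyw => hyw.trans (mul_le_mul_of_nonneg_right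
        (le_max_left A (D / η')) (Metric.infDist_nonneg (x := w) (s := Uᶜ))), ?_,
      fun a ha b hb => hfar a (h1 a ha) b hb⟩
    · exact List.pairwise_of_forall_mem_list fun a ha b hb =>
        hfar a (g1 a (List.mem_cons_of_mem z ha)).1 b hb
  · rcases List.eq_nil_or_concat l₂ with rfl | ⟨l, b, rfl⟩
    · simp only [List.append_nil]
      exact g3
    · rw [List.getLast_cons (by simp)] at g3
      simp only [hcat]
      rw [List.getLast_append_of_right_ne_nil _ _ (by simp), g3]

end Interior

/-- Moving by `t` along `ν` gains height `t` over the graph. A further displacement of length less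
than `c t` loses less than `c t + K c t`, and `c = 1 / (1 + K)` makes this equal to `t`. So the
distance to the complement grows at least like `c t`. -/
theorem IsLipschitzDomain.exists_escapeChains {n : ℕ} {U : Set (EuclideanSpace ℝ (Fin n))}
    (h : IsLipschitzDomain U) (hne : Uᶜ.Nonempty) {ε : ℝ} (hε : 0 < ε)
    {x : EuclideanSpace ℝ (Fin n)} (hx : x ∈ frontier U) :
    ∃ t ∈ nhds x, ∃ A η : ℝ, 0 < η ∧ EscapeChains U t ε A η := by
  obtain ⟨⟨hU, -, -⟩, hloc⟩ := h
  obtain ⟨r, hr, ν, hν, K, g, hg, hgU⟩ := hloc x hx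
  set c : ℝ := 1 / (1 + K) with hc
  have hc0 : 0 < c := by positivity
  have hK0 : (0 : ℝ) ≤ K := K.2
  have hcK : c + K * c = 1 := by rw [hc]; field_simp
  have hc1 : c ≤ 1 := by nlinarith [mul_nonneg hK0 hc0.le]
  -- With `t ≤ r / 8` and `c ≤ 1`, all points involved stay within `r / 2 + r / 4` of `x`, where the
  -- graph describes `U`.
  have hball : ∀ y ∈ Metric.ball x (r / 2) ∩ U, ∀ t, 0 ≤ t → t ≤ r / 8 →
      Metric.ball (y + t • ν) (c * t) ⊆ U := by
    rintro y ⟨hyx, hyU⟩ t ht htr z hz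
    rw [Metric.mem_ball] at hyx hz
    have hyt : dist (y + t • ν) y = t := by
      rw [dist_eq_norm, add_sub_cancel_left, norm_smul, hν, mul_one, Real.norm_of_nonneg ht]
    have hct : c * t ≤ t := by nlinarith
    have hzx : z ∈ Metric.ball x r := by
      rw [Metric.mem_ball]
      linarith [dist_triangle4 z (y + t • ν) y x]
    have hyr : y ∈ Metric.ball x r := by rw [Metric.mem_ball]; linarith
    rw [hgU z hzx]
    have h1 := (hgU y hyr).1 hyU
    set P := (Submodule.span ℝ {ν})ᗮ.orthogonalProjectionOnto
    have hPν : P ν = 0 := Submodule.orthogonalProjectionOnto_orthogonal_apply_eq_zero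
      (Submodule.mem_span_singleton_self ν)
    have hP : dist (P z) (P y) ≤ c * t := by
      have : P z - P y = P (z - (y + t • ν)) := by simp [hPν]
      rw [dist_eq_norm, this]
      refine (Submodule.norm_orthogonalProjectionOnto_apply_le _ _).trans ?_
      rw [← dist_eq_norm]; exact hz.le
    have h2 : g (P z) ≤ g (P y) + K * (c * t) := by
      have h3 := hg.dist_le_mul (P z) (P y)
      rw [Real.dist_eq] at h3
      have h4 : (K : ℝ) * dist (P z) (P y) ≤ K * (c * t) := by gcongr
      linarith [le_abs_self (g (P z) - g (P y))]
    have h5 : inner ℝ ν z = inner ℝ ν y + t + inner ℝ ν (z - (y + t • ν)) := by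
      rw [inner_sub_right, inner_add_right, inner_smul_right, real_inner_self_eq_norm_sq, hν]
      ring
    have h6 : |inner ℝ ν (z - (y + t • ν))| ≤ c * t := by
      refine (abs_real_inner_le_norm _ _).trans ?_
      rw [hν, one_mul, ← dist_eq_norm]; exact hz.le
    have h7 : c * t + K * (c * t) = t := by rw [← mul_assoc, ← add_mul, hcK, one_mul]
    rcases ht.eq_or_lt with rfl | ht0
    · simp at hz
      exact absurd hz dist_nonneg.not_gt
    · linarith [neg_abs_le (inner ℝ ν (z - (y + t • ν)))]
  refine ⟨_, Metric.ball_mem_nhds x (half_pos hr), 1 / c, c * (r / 8), by positivity, ?_⟩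
  intro y hy
  have hyU : ∀ t ∈ Set.Icc 0 (r / 8), y + t • ν ∈ U := by
    rintro t ⟨ht, htr⟩
    rcases ht.eq_or_lt with rfl | ht0
    · simpa using hy.2
    · exact hball y hy t ht htr (Metric.mem_ball_self (by positivity))
  have hd : ∀ t, 0 ≤ t → t ≤ r / 8 → c * t ≤ Metric.infDist (y + t • ν) Uᶜ :=
    fun t ht htr => le_infDist_compl_of_ball_subset hne (hball y hy t ht htr)
  obtain ⟨l, h1, h2, h3, h4⟩ := exists_chain_of_path (γ := fun t : ℝ => y + t • ν) hU hne
    (show 0 ≤ r / 8 by positivity) (by fun_prop) hyU hε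
  simp only [zero_smul, add_zero] at h1 h2 h3 h4
  refine ⟨l, fun z hz => ?_, h1, h3.imp ?_, ?_⟩
  · obtain ⟨t, ht, rfl⟩ := h2 z hz
    exact hyU t ht
  · rintro u v ⟨a, b, ha, hab, hb, rfl, rfl⟩
    have h5 := hd b (ha.trans hab) hb
    have h6 : dist (y + a • ν) (y + b • ν) = b - a := by
      rw [dist_add_left, dist_comm, dist_eq_norm, ← sub_smul, norm_smul, hν, mul_one,
        Real.norm_of_nonneg (sub_nonneg.2 hab)]
    rw [h6, one_div, ← div_eq_inv_mul, le_div_iff₀ hc0]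
    nlinarith
  · rw [h4]
    exact hd (r / 8) (by positivity) le_rfl

theorem IsLipschitzDomain.exists_chainCondition {n : ℕ} {U : Set (EuclideanSpace ℝ (Fin n))}
    (h : IsLipschitzDomain U) (hne : Uᶜ.Nonempty) {ε : ℝ} (hε : 0 < ε) :
    ∃ x₀ ∈ U, ∃ A, 0 ≤ A ∧ ChainCondition U x₀ ε A := by
  obtain ⟨hU, hc, hb⟩ := h.1
  obtain ⟨x₀, hx₀⟩ := hc.nonempty
  obtain ⟨A, η, hη, hesc⟩ := exists_escapeChains_of_local (U := U) hb.isCompact_closure (ε := ε)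
    fun x hx => by
      rw [closure_eq_self_union_frontier] at hx
      rcases hx with hx | hx
      · exact exists_escapeChains_of_mem hU hne hx ε
      · exact h.exists_escapeChains hne hε hx
  exact ⟨x₀, hx₀, chainCondition_of_escapeChains hU hc hb hne hx₀ hε hη
    (hesc.mono subset_closure le_rfl le_rfl)⟩

/-- Passing to the sup norm does not increase distances and shrinks the distance to the complement
by at most the factor `C`. -/
theorem ChainCondition.preimage_toLp {n : ℕ} {U : Set (EuclideanSpace ℝ (Fin n))}
    {x₀ : EuclideanSpace ℝ (Fin n)} {ε A : ℝ} (hε : 0 ≤ ε) (hA : 0 ≤ A) (hne : Uᶜ.Nonempty)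
    {C : ℝ≥0} (hC : LipschitzWith C (WithLp.toLp 2 : (Fin n → ℝ) → EuclideanSpace ℝ (Fin n)))
    (h : ChainCondition U x₀ ε A) :
    ChainCondition (WithLp.toLp 2 ⁻¹' U : Set (Fin n → ℝ)) (WithLp.ofLp x₀) (ε * C) (A * C) := by
  intro x hx
  obtain ⟨l, h1, h2, h3, h4⟩ := h _ hx
  have hdist : ∀ y z : EuclideanSpace ℝ (Fin n), dist (WithLp.ofLp y) (WithLp.ofLp z) ≤ dist y z :=
    fun y z => by simpa using (PiLp.lipschitzWith_ofLp 2 fun _ : Fin n => ℝ).dist_le_mul y z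
  have hinf : ∀ y : EuclideanSpace ℝ (Fin n), Metric.infDist y Uᶜ ≤
      C * Metric.infDist (WithLp.ofLp y) (WithLp.toLp 2 ⁻¹' U : Set (Fin n → ℝ))ᶜ := by
    intro y
    rcases (NNReal.coe_nonneg C).eq_or_lt with hC0 | hC0
    · obtain ⟨w, hw⟩ := hne
      have h5 := hC.dist_le_mul (WithLp.ofLp y) (WithLp.ofLp w)
      rw [← hC0, zero_mul] at h5 ⊢
      exact (Metric.infDist_le_dist_of_mem hw).trans h5
    · rw [← div_le_iff₀' hC0, Metric.le_infDist ⟨WithLp.ofLp hne.some, hne.some_mem⟩]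
      intro w hw
      rw [div_le_iff₀' hC0]
      exact (Metric.infDist_le_dist_of_mem (show WithLp.toLp 2 w ∈ Uᶜ from hw)).trans
        (hC.dist_le_mul (WithLp.ofLp y) w)
  have hcons : x :: l.map WithLp.ofLp = (WithLp.toLp 2 x :: l).map WithLp.ofLp := rfl
  refine ⟨l.map WithLp.ofLp, ?_, ?_, ?_, ?_⟩
  · rw [hcons]
    intro y hy
    obtain ⟨z, hz, rfl⟩ := List.mem_map.1 hy
    exact h1 z hz
  · rw [hcons, List.isChain_map]
    refine h2.imp fun y z hyz => (hdist y z).trans (hyz.trans ?_)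
    rw [mul_assoc]
    gcongr
    exact hinf y
  · rw [hcons, List.pairwise_map]
    refine h3.imp fun {y z} hyz => (hdist y z).trans (hyz.trans ?_)
    rw [mul_assoc]
    gcongr
    exact hinf z
  · simp only [hcons]
    rw [List.getLast_map, h4]

/-! ### Transfer to Euclidean space -/

section Transfer

variable {n : ℕ} {U : Set (EuclideanSpace ℝ (Fin n))} {ψ : EuclideanSpace ℝ (Fin n) → ℝ}

lemma measurePreserving_toLp (n : ℕ) :
    MeasurePreserving (WithLp.toLp 2 : (Fin n → ℝ) → EuclideanSpace ℝ (Fin n)) volume volume :=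
  PiLp.volume_preserving_toLp (Fin n)

lemma measurableEmbedding_toLp (n : ℕ) :
    MeasurableEmbedding (WithLp.toLp 2 : (Fin n → ℝ) → EuclideanSpace ℝ (Fin n)) :=
  (MeasurableEquiv.toLp 2 (Fin n → ℝ)).measurableEmbedding

lemma isOpen_cube (c : EuclideanSpace ℝ (Fin n)) (r : ℝ) : IsOpen (cube c r) := by
  simp only [cube, Set.ofPred_forall]
  exact isOpen_iInter_of_finite fun i => isOpen_lt (by fun_prop) continuous_const

lemma toLp_preimage_cube (c : Fin n → ℝ) {r : ℝ} (hr : 0 < r) :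
    WithLp.toLp 2 ⁻¹' cube (WithLp.toLp 2 c) r = Metric.ball c r := by
  ext x
  simp [cube, dist_pi_lt_iff hr, Real.dist_eq]

lemma volume_cube (c : EuclideanSpace ℝ (Fin n)) {r : ℝ} (hr : 0 < r) :
    volume (cube c r) ≠ 0 ∧ volume (cube c r) ≠ ∞ := by
  have h1 := (measurePreserving_toLp n).measure_preimage_emb (measurableEmbedding_toLp n) (cube c r)
  have h2 : WithLp.toLp 2 ⁻¹' cube c r = Metric.ball (WithLp.ofLp c) r :=
    toLp_preimage_cube (WithLp.ofLp c) hr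
  rw [← h1, h2]
  exact ⟨(Metric.measure_ball_pos volume _ hr).ne', measure_ball_lt_top.ne⟩

lemma setAverage_comp_toLp (g : EuclideanSpace ℝ (Fin n) → ℝ)
    (s : Set (EuclideanSpace ℝ (Fin n))) :
    ⨍ x in WithLp.toLp 2 ⁻¹' s, g (WithLp.toLp 2 x) = ⨍ x in s, g x := by
  rw [setAverage_eq, setAverage_eq, (measurePreserving_toLp n).setIntegral_preimage_emb
    (measurableEmbedding_toLp n), measureReal_def, measureReal_def,
    (measurePreserving_toLp n).measure_preimage_emb (measurableEmbedding_toLp n)]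

lemma oscLEOne_of_bmoSeminorm_le {t : ℝ} (ht : 0 < t)
    (h : bmoSeminorm U ψ ≤ ENNReal.ofReal t) :
    OscLEOne (WithLp.toLp 2 ⁻¹' U) fun x => t⁻¹ * ψ (WithLp.toLp 2 x) := by
  intro c r hr hc
  have hsub : cube (WithLp.toLp 2 c) r ⊆ U := by
    intro x hx
    have h1 : WithLp.ofLp x ∈ WithLp.toLp 2 ⁻¹' cube (WithLp.toLp 2 c) r := hx
    rw [toLp_preimage_cube c hr] at h1
    exact hc h1
  have h2 : ⨍⁻ x in cube (WithLp.toLp 2 c) r,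
      ‖ψ x - ⨍ y in cube (WithLp.toLp 2 c) r, ψ y‖ₑ ∂volume ≤ ENNReal.ofReal t := by
    refine le_trans ?_ h
    exact le_iSup_of_le _ (le_iSup_of_le r (le_iSup_of_le hr (le_iSup_of_le hsub le_rfl)))
  obtain ⟨h0, h0'⟩ := volume_cube (WithLp.toLp 2 c) hr
  rw [setLAverage_eq, ENNReal.div_le_iff h0 h0'] at h2
  rw [← toLp_preimage_cube c hr,
    setAverage_comp_toLp (fun x => t⁻¹ * ψ x),
    (measurePreserving_toLp n).setLIntegral_comp_preimage_emb (measurableEmbedding_toLp n)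
      (fun x => ‖t⁻¹ * ψ x - ⨍ y in cube (WithLp.toLp 2 c) r, t⁻¹ * ψ y‖ₑ),
    (measurePreserving_toLp n).measure_preimage_emb (measurableEmbedding_toLp n)]
  have h3 : ⨍ y in cube (WithLp.toLp 2 c) r, t⁻¹ * ψ y =
      t⁻¹ * ⨍ y in cube (WithLp.toLp 2 c) r, ψ y := by
    rw [setAverage_eq, setAverage_eq, integral_const_mul, smul_eq_mul, smul_eq_mul]; ring
  simp only [h3, ← mul_sub, enorm_mul]
  rw [lintegral_const_mul' _ _ enorm_ne_top]
  calc ‖t⁻¹‖ₑ * ∫⁻ x in cube (WithLp.toLp 2 c) r,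
        ‖ψ x - ⨍ y in cube (WithLp.toLp 2 c) r, ψ y‖ₑ
      ≤ ‖t⁻¹‖ₑ * (ENNReal.ofReal t * volume (cube (WithLp.toLp 2 c) r)) := by gcongr
    _ = volume (cube (WithLp.toLp 2 c) r) := by
        rw [← mul_assoc, Real.enorm_of_nonneg (inv_nonneg.2 ht.le),
          ← ENNReal.ofReal_mul (inv_nonneg.2 ht.le), inv_mul_cancel₀ ht.ne', ENNReal.ofReal_one,
          one_mul]

lemma lintegral_comp_toLp_rpow {t : ℝ} (ht : 0 < t) {q : ℝ} (hq : 0 ≤ q) :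
    ∫⁻ x in U, ‖ψ x‖ₑ ^ q = ENNReal.ofReal (t ^ q) *
      ∫⁻ x in WithLp.toLp 2 ⁻¹' U, ‖t⁻¹ * ψ (WithLp.toLp 2 x)‖ₑ ^ q := by
  rw [(measurePreserving_toLp n).setLIntegral_comp_preimage_emb (measurableEmbedding_toLp n)
      (fun x => ‖t⁻¹ * ψ x‖ₑ ^ q), ← lintegral_const_mul' _ _ ENNReal.ofReal_ne_top]
  refine lintegral_congr fun x => ?_
  rw [enorm_mul, ENNReal.mul_rpow_of_nonneg _ _ hq, ← mul_assoc,
    Real.enorm_of_nonneg (inv_nonneg.2 ht.le), ENNReal.ofReal_rpow_of_pos (inv_pos.2 ht),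
    ← ENNReal.ofReal_mul (by positivity), Real.inv_rpow ht.le,
    mul_inv_cancel₀ (Real.rpow_pos_of_pos ht q).ne', ENNReal.ofReal_one, one_mul]

/-- Dividing by a positive `t` above the norm, not by the norm itself, avoids the case of norm zero.
-/
lemma normalized_of_bmoL1Norm_le (h : MemBMOL1 U ψ) {t : ℝ} (ht : 0 < t)
    (hle : bmoL1Norm U ψ ≤ t) :
    IntegrableOn (fun x => t⁻¹ * ψ (WithLp.toLp 2 x)) (WithLp.toLp 2 ⁻¹' U) ∧
    OscLEOne (WithLp.toLp 2 ⁻¹' U) (fun x => t⁻¹ * ψ (WithLp.toLp 2 x)) ∧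
    |⨍ x in WithLp.toLp 2 ⁻¹' U, t⁻¹ * ψ (WithLp.toLp 2 x)| ≤ 1 := by
  unfold bmoL1Norm at hle
  have h1 := ENNReal.toReal_nonneg (a := bmoSeminorm U ψ)
  refine ⟨?_, oscLEOne_of_bmoSeminorm_le ht ?_, ?_⟩
  · exact (((measurePreserving_toLp n).integrableOn_comp_preimage
      (measurableEmbedding_toLp n)).2 h.2).const_mul _
  · rw [← ENNReal.ofReal_toReal h.1.2.ne]
    exact ENNReal.ofReal_le_ofReal (by linarith [abs_nonneg (⨍ x in U, ψ x)])
  · rw [setAverage_comp_toLp (fun x => t⁻¹ * ψ x), setAverage_eq, integral_const_mul,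
      smul_eq_mul, mul_left_comm, ← smul_eq_mul (a := (volume.real U)⁻¹), ← setAverage_eq, abs_mul,
      abs_of_pos (inv_pos.2 ht), inv_mul_le_iff₀ ht]
    linarith

/-- The chain condition, in the sup norm, with the data on which the estimates depend. -/
lemma exists_chainCondition_toLp [Nonempty (Fin n)] (h : IsLipschitzDomain U ∨ IsJohnDomain U) :
    IsOpen (WithLp.toLp 2 ⁻¹' U : Set (Fin n → ℝ)) ∧
    Bornology.IsBounded (WithLp.toLp 2 ⁻¹' U : Set (Fin n → ℝ)) ∧
    ∃ x₀ ∈ (WithLp.toLp 2 ⁻¹' U : Set (Fin n → ℝ)), ∃ A, 0 ≤ A ∧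
      ChainCondition (WithLp.toLp 2 ⁻¹' U : Set (Fin n → ℝ)) x₀ (1 / 4) A := by
  obtain ⟨hU, hc, hb⟩ : IsBoundedDomain U := h.elim (fun h => h.1) fun h => h.1
  have hne : Uᶜ.Nonempty := by
    by_contra hcon
    rw [Set.not_nonempty_iff_eq_empty, Set.compl_empty_iff] at hcon
    rw [hcon] at hb
    exact NormedSpace.unbounded_univ ℝ (EuclideanSpace ℝ (Fin n)) hb
  have hlip := PiLp.lipschitzWith_toLp 2 fun _ : Fin n => ℝ
  have hcont : Continuous (WithLp.toLp 2 : (Fin n → ℝ) → EuclideanSpace ℝ (Fin n)) :=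
    hlip.continuous
  set C : ℝ≥0 := (Fintype.card (Fin n) : ℝ≥0) ^ (1 / (2 : ℝ≥0∞)).toReal with hC
  have hC0 : (0 : ℝ) < C := by
    rw [hC]
    have : 0 < Fintype.card (Fin n) := Fintype.card_pos
    positivity
  refine ⟨hU.preimage hcont, ?_, ?_⟩
  · have h2 := (PiLp.antilipschitzWith_toLp 2 fun _ : Fin n => ℝ).isBounded_preimage hb
    exact h2
  -- The step `1 / (4 * C)` becomes `1 / 4` in the sup norm.
  · obtain ⟨x₀, hx₀, A, hA, hch⟩ : ∃ x₀ ∈ U, ∃ A, 0 ≤ A ∧ ChainCondition U x₀ (1 / (4 * C)) A :=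
      h.elim (fun h => h.exists_chainCondition hne (by positivity))
        fun h => h.exists_chainCondition hne (by positivity)
    refine ⟨WithLp.ofLp x₀, hx₀, A * C, by positivity, ?_⟩
    have h3 := hch.preimage_toLp (by positivity) hA hne hlip
    have h4 : 1 / (4 * (C : ℝ)) * C = 1 / 4 := by field_simp
    rwa [h4] at h3

theorem exists_lintegral_rpow_le [Nonempty (Fin n)] (h : IsLipschitzDomain U ∨ IsJohnDomain U)
    {q : ℝ} (hq : 1 ≤ q) :
    ∃ K : ℝ≥0∞, K ≠ ∞ ∧ ∀ ψ, MemBMOL1 U ψ → ∀ t, 0 < t → bmoL1Norm U ψ ≤ t →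
      ∫⁻ x in U, ‖ψ x‖ₑ ^ q ≤ ENNReal.ofReal (t ^ q) * K := by
  obtain ⟨hU, hb, x₀, hx₀, A, hA, hch⟩ := exists_chainCondition_toLp h
  have hm : ⌈q⌉₊ ≠ 0 := (Nat.ceil_pos.2 (by linarith)).ne'
  obtain ⟨K, hK, hle⟩ := exists_lintegral_domain_le hU hb hx₀ hA hch ⌈q⌉₊ hm
  refine ⟨volume (WithLp.toLp 2 ⁻¹' U : Set (Fin n → ℝ)) + K,
    ENNReal.add_ne_top.2 ⟨hb.measure_lt_top.ne, hK⟩, fun ψ hψ t ht hnorm => ?_⟩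
  obtain ⟨h1, h2, h3⟩ := normalized_of_bmoL1Norm_le hψ ht hnorm
  rw [lintegral_comp_toLp_rpow ht (by linarith : 0 ≤ q)]
  gcongr
  calc _ ≤ ∫⁻ x in (WithLp.toLp 2 ⁻¹' U : Set (Fin n → ℝ)),
        (1 + ‖t⁻¹ * ψ (WithLp.toLp 2 x)‖ₑ ^ ⌈q⌉₊) :=
        lintegral_mono fun x => rpow_le_one_add_pow _ (by linarith) (Nat.le_ceil q)
    _ ≤ _ := by
        rw [lintegral_add_left measurable_const, setLIntegral_const, one_mul]
        gcongr
        exact hle _ h1 h2 h3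

theorem exists_lintegral_rpow_le_lintegral_rpow [Nonempty (Fin n)]
    (h : IsLipschitzDomain U ∨ IsJohnDomain U) {p q : ℝ} (hp : 1 ≤ p) (hpq : p < q) :
    ∃ K : ℝ≥0∞, K ≠ ∞ ∧ ∀ ψ, MemBMOL1 U ψ → ∀ t, 0 < t → bmoL1Norm U ψ ≤ t →
      ∫⁻ x in U, ‖ψ x‖ₑ ^ q ≤ ENNReal.ofReal (t ^ (q - p)) * K * ∫⁻ x in U, ‖ψ x‖ₑ ^ p := by
  obtain ⟨hU, hb, x₀, hx₀, A, hA, hch⟩ := exists_chainCondition_toLp h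
  obtain ⟨K, hK, hle⟩ := exists_lintegral_domain_rpow_le hU hb hx₀ hA hch hp hpq
  refine ⟨K, hK, fun ψ hψ t ht hnorm => ?_⟩
  obtain ⟨h1, h2, h3⟩ := normalized_of_bmoL1Norm_le hψ ht hnorm
  rw [lintegral_comp_toLp_rpow (q := q) ht (by linarith), lintegral_comp_toLp_rpow (q := p) ht
    (by linarith)]
  calc _ ≤ ENNReal.ofReal (t ^ q) * (K * ∫⁻ x in (WithLp.toLp 2 ⁻¹' U : Set (Fin n → ℝ)),
        ‖t⁻¹ * ψ (WithLp.toLp 2 x)‖ₑ ^ p) := by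
        gcongr
        exact hle _ h1 h2 h3
    _ = _ := by
        have h4 : t ^ q = t ^ (q - p) * t ^ p := by rw [← Real.rpow_add ht]; congr 1; ring
        rw [h4, ENNReal.ofReal_mul (by positivity)]
        ring

lemma lintegral_enorm_rpow_ne_top [Nonempty (Fin n)] (h : IsLipschitzDomain U ∨ IsJohnDomain U)
    {q : ℝ} (hq : 1 ≤ q) (hψ : MemBMOL1 U ψ) : ∫⁻ x in U, ‖ψ x‖ₑ ^ q ≠ ∞ := by
  obtain ⟨K, hK, hle⟩ := exists_lintegral_rpow_le h hq
  exact ne_top_of_le_ne_top (ENNReal.mul_ne_top ENNReal.ofReal_ne_top hK)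
    (hle ψ hψ (|bmoL1Norm U ψ| + 1) (by positivity) (by linarith [le_abs_self (bmoL1Norm U ψ)]))

theorem memLp_of_memBMOL1 [Nonempty (Fin n)] (h : IsLipschitzDomain U ∨ IsJohnDomain U) {q : ℝ}
    (hq : 1 ≤ q) (hψ : MemBMOL1 U ψ) : MemLp ψ (ENNReal.ofReal q) (volume.restrict U) := by
  refine ⟨hψ.2.aestronglyMeasurable, ?_⟩
  rw [eLpNorm_lt_top_iff_lintegral_rpow_enorm_lt_top (by simp; linarith) ENNReal.ofReal_ne_top,
    ENNReal.toReal_ofReal (by linarith)]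
  exact (lintegral_enorm_rpow_ne_top h hq hψ).lt_top

lemma integral_abs_rpow_eq {q : ℝ} (hq : 0 ≤ q) (hψ : MemBMOL1 U ψ) :
    ∫ x in U, |ψ x| ^ q = (∫⁻ x in U, ‖ψ x‖ₑ ^ q).toReal := by
  rw [integral_eq_lintegral_of_nonneg_ae (Filter.Eventually.of_forall fun x => by positivity)]
  · congr 1
    refine lintegral_congr fun x => ?_
    rw [Real.enorm_eq_ofReal_abs, ENNReal.ofReal_rpow_of_nonneg (abs_nonneg _) hq]
  · exact (hψ.2.aestronglyMeasurable.aemeasurable.abs.pow_const q).aestronglyMeasurable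

lemma bmoL1Norm_nonneg (U : Set (EuclideanSpace ℝ (Fin n))) (ψ : EuclideanSpace ℝ (Fin n) → ℝ) :
    0 ≤ bmoL1Norm U ψ := add_nonneg ENNReal.toReal_nonneg (abs_nonneg _)

/-- This lets `t` decrease to the norm, which may be zero. -/
lemma le_of_forall_gt_of_continuous {f : ℝ → ℝ} (hf : Continuous f) {a N : ℝ}
    (h : ∀ t, N < t → a ≤ f t) : a ≤ f N :=
  ge_of_tendsto (hf.continuousWithinAt (s := Set.Ioi N) (x := N)).tendsto
    (Filter.eventually_of_mem self_mem_nhdsWithin h)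

theorem exists_average_bound [Nonempty (Fin n)] (h : IsLipschitzDomain U ∨ IsJohnDomain U) {q : ℝ}
    (hq : 1 ≤ q) : ∃ C, 0 < C ∧ ∀ ψ, MemBMOL1 U ψ →
      (⨍ x in U, |ψ x| ^ q) ^ (1 / q) ≤ C * bmoL1Norm U ψ := by
  have hq0 : 0 < q := by linarith
  obtain ⟨K, hK, hle⟩ := exists_lintegral_rpow_le h hq
  set k := (volume.real U)⁻¹ * K.toReal with hk
  have hk0 : 0 ≤ k := by positivity
  -- The summand 1 only ensures that the constant is positive.
  refine ⟨k ^ (1 / q) + 1, by positivity, fun ψ hψ => ?_⟩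
  have hN := bmoL1Norm_nonneg U ψ
  refine le_trans ?_ (mul_le_mul_of_nonneg_right (le_add_of_nonneg_right zero_le_one) hN)
  refine le_of_forall_gt_of_continuous (f := fun t => k ^ (1 / q) * t) (by fun_prop) fun t ht => ?_
  have ht0 : 0 < t := hN.trans_lt ht
  have h1 : ∫ x in U, |ψ x| ^ q ≤ t ^ q * K.toReal := by
    rw [integral_abs_rpow_eq hq0.le hψ, ← ENNReal.toReal_ofReal (show 0 ≤ t ^ q by positivity),
      ← ENNReal.toReal_mul]
    exact ENNReal.toReal_mono (ENNReal.mul_ne_top ENNReal.ofReal_ne_top hK)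
      (hle ψ hψ t ht0 ht.le)
  have h2 : ⨍ x in U, |ψ x| ^ q ≤ k * t ^ q := by
    rw [setAverage_eq, smul_eq_mul, hk, mul_assoc, mul_comm K.toReal]
    gcongr
  have h3 : 0 ≤ ⨍ x in U, |ψ x| ^ q := by
    rw [setAverage_eq, smul_eq_mul]
    exact mul_nonneg (by positivity) (integral_nonneg fun x => by positivity)
  calc (⨍ x in U, |ψ x| ^ q) ^ (1 / q) ≤ (k * t ^ q) ^ (1 / q) :=
        Real.rpow_le_rpow h3 h2 (by positivity)
    _ = k ^ (1 / q) * t := by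
        rw [Real.mul_rpow hk0 (by positivity), ← Real.rpow_mul ht0.le, mul_one_div_cancel hq0.ne',
          Real.rpow_one]

theorem exists_interpolation_bound [Nonempty (Fin n)] (h : IsLipschitzDomain U ∨ IsJohnDomain U)
    {p q : ℝ} (hp : 1 ≤ p) (hpq : p < q) : ∃ C, 0 < C ∧ ∀ ψ, MemBMOL1 U ψ →
      normLp q U ψ ≤ C * bmoL1Norm U ψ ^ (1 - p / q) * normLp p U ψ ^ (p / q) := by
  have hp0 : 0 < p := by linarith
  have hq0 : 0 < q := by linarith
  obtain ⟨K, hK, hle⟩ := exists_lintegral_rpow_le_lintegral_rpow h hp hpq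
  set k := K.toReal with hk
  have hk0 : 0 ≤ k := ENNReal.toReal_nonneg
  have he : 0 ≤ 1 - p / q := sub_nonneg.2 ((div_le_one hq0).2 hpq.le)
  refine ⟨k ^ (1 / q) + 1, by positivity, fun ψ hψ => ?_⟩
  have hN := bmoL1Norm_nonneg U ψ
  have hI0 : ∀ r : ℝ, 0 ≤ ∫ x in U, |ψ x| ^ r := fun r => integral_nonneg fun x => by positivity
  have hP0 : 0 ≤ normLp p U ψ := Real.rpow_nonneg (hI0 p) _
  refine le_trans (b := k ^ (1 / q) * bmoL1Norm U ψ ^ (1 - p / q) * normLp p U ψ ^ (p / q)) ?_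
    (by gcongr; linarith)
  refine le_of_forall_gt_of_continuous
    (f := fun t => k ^ (1 / q) * t ^ (1 - p / q) * normLp p U ψ ^ (p / q))
    ((continuous_const.mul (Real.continuous_rpow_const he)).mul continuous_const) fun t ht => ?_
  have ht0 : 0 < t := hN.trans_lt ht
  have hIp := lintegral_enorm_rpow_ne_top h hp hψ
  have h1 : ∫ x in U, |ψ x| ^ q ≤ k * t ^ (q - p) * ∫ x in U, |ψ x| ^ p := by
    rw [integral_abs_rpow_eq hq0.le hψ, integral_abs_rpow_eq hp0.le hψ, mul_comm k,
      ← ENNReal.toReal_ofReal (show 0 ≤ t ^ (q - p) by positivity), hk,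
      ← ENNReal.toReal_mul, ← ENNReal.toReal_mul]
    exact ENNReal.toReal_mono
      (ENNReal.mul_ne_top (ENNReal.mul_ne_top ENNReal.ofReal_ne_top hK) hIp)
      (hle ψ hψ t ht0 ht.le)
  calc normLp q U ψ ≤ (k * t ^ (q - p) * ∫ x in U, |ψ x| ^ p) ^ (1 / q) :=
        Real.rpow_le_rpow (hI0 q) h1 (by positivity)
    _ = _ := by
        unfold normLp
        rw [Real.mul_rpow (by positivity) (hI0 p), Real.mul_rpow hk0 (by positivity),
          ← Real.rpow_mul ht0.le, ← Real.rpow_mul (hI0 p)]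
        congr 3 <;> field_simp

end Transfer

/-! ### Invariance under scaling and translation -/

section Scaling

variable {n : ℕ} {l : ℝ} {a : EuclideanSpace ℝ (Fin n)} {V : Set (EuclideanSpace ℝ (Fin n))}

lemma hasFDerivWithinAt_smul_add (l : ℝ) (a x : EuclideanSpace ℝ (Fin n))
    (V : Set (EuclideanSpace ℝ (Fin n))) :
    HasFDerivWithinAt (fun y => l • y + a) (l • ContinuousLinearMap.id ℝ _) V x :=
  (((hasFDerivWithinAt_id x V).const_smul l).add_const a)

lemma injective_smul_add (hl : 0 < l) (a : EuclideanSpace ℝ (Fin n)) :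
    Function.Injective fun y : EuclideanSpace ℝ (Fin n) => l • y + a := fun x y hxy => by
  simpa [hl.ne'] using hxy

lemma abs_det_smul_id (n : ℕ) (hl : 0 < l) :
    |(l • ContinuousLinearMap.id ℝ (EuclideanSpace ℝ (Fin n))).det| = l ^ n := by
  have : (l • ContinuousLinearMap.id ℝ (EuclideanSpace ℝ (Fin n))).det = l ^ n := by
    rw [ContinuousLinearMap.det]
    simp
  rw [this, abs_of_pos (pow_pos hl n)]

lemma lintegral_image_smul_add (hl : 0 < l) (hV : MeasurableSet V)
    (g : EuclideanSpace ℝ (Fin n) → ℝ≥0∞) :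
    ∫⁻ x in (fun y => l • y + a) '' V, g x =
      ENNReal.ofReal (l ^ n) * ∫⁻ x in V, g (l • x + a) := by
  rw [lintegral_image_eq_lintegral_abs_det_fderiv_mul volume hV
    (fun x _ => hasFDerivWithinAt_smul_add l a x V) (injective_smul_add hl a).injOn]
  simp only [abs_det_smul_id n hl]
  rw [lintegral_const_mul' _ _ ENNReal.ofReal_ne_top]

lemma integral_image_smul_add (hl : 0 < l) (hV : MeasurableSet V)
    (g : EuclideanSpace ℝ (Fin n) → ℝ) :
    ∫ x in (fun y => l • y + a) '' V, g x = l ^ n * ∫ x in V, g (l • x + a) := by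
  rw [integral_image_eq_integral_abs_det_fderiv_smul volume hV
    (fun x _ => hasFDerivWithinAt_smul_add l a x V) (injective_smul_add hl a).injOn]
  simp only [abs_det_smul_id n hl, smul_eq_mul]
  rw [integral_const_mul]

lemma volume_image_smul_add (hl : 0 < l) (hV : MeasurableSet V) :
    volume ((fun y => l • y + a) '' V) = ENNReal.ofReal (l ^ n) * volume V := by
  simpa using lintegral_image_smul_add (a := a) hl hV fun _ => 1

lemma setAverage_image_smul_add (hl : 0 < l) (hV : MeasurableSet V)
    (g : EuclideanSpace ℝ (Fin n) → ℝ) :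
    ⨍ x in (fun y => l • y + a) '' V, g x = ⨍ x in V, g (l • x + a) := by
  have h := pow_pos hl n
  rw [setAverage_eq, setAverage_eq, integral_image_smul_add hl hV, measureReal_def,
    volume_image_smul_add hl hV, ENNReal.toReal_mul, ENNReal.toReal_ofReal h.le, ← measureReal_def,
    smul_eq_mul, smul_eq_mul, mul_inv, mul_mul_mul_comm, inv_mul_cancel₀ h.ne', one_mul]

lemma setLAverage_image_smul_add (hl : 0 < l) (hV : MeasurableSet V)
    (g : EuclideanSpace ℝ (Fin n) → ℝ≥0∞) :
    ⨍⁻ x in (fun y => l • y + a) '' V, g x ∂volume = ⨍⁻ x in V, g (l • x + a) ∂volume := by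
  rw [setLAverage_eq, setLAverage_eq, lintegral_image_smul_add hl hV, volume_image_smul_add hl hV]
  exact ENNReal.mul_div_mul_left _ _ (by simpa using pow_pos hl n) ENNReal.ofReal_ne_top

lemma integrableOn_image_smul_add (hl : 0 < l) (hV : MeasurableSet V)
    (g : EuclideanSpace ℝ (Fin n) → ℝ) :
    IntegrableOn g ((fun y => l • y + a) '' V) ↔ IntegrableOn (fun x => g (l • x + a)) V := by
  rw [integrableOn_image_iff_integrableOn_abs_det_fderiv_smul volume hV
    (fun x _ => hasFDerivWithinAt_smul_add l a x V) (injective_smul_add hl a).injOn]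
  simp only [abs_det_smul_id n hl, smul_eq_mul]
  exact integrable_const_mul_iff (isUnit_iff_ne_zero.2 (pow_pos hl n).ne') _

lemma image_smul_add_cube (hl : 0 < l) (c a : EuclideanSpace ℝ (Fin n)) (r : ℝ) :
    (fun y => l • y + a) '' cube c r = cube (l • c + a) (l * r) := by
  ext x
  have key : ∀ y : EuclideanSpace ℝ (Fin n), l • y + a ∈ cube (l • c + a) (l * r) ↔
      y ∈ cube c r := fun y => by
    simp only [cube, Set.mem_ofPred_eq, PiLp.add_apply, PiLp.smul_apply, smul_eq_mul]
    refine forall_congr' fun i => ?_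
    rw [add_sub_add_right_eq_sub, ← mul_sub, abs_mul, abs_of_pos hl, mul_lt_mul_iff_right₀ hl]
  constructor
  · rintro ⟨y, hy, rfl⟩
    exact (key y).2 hy
  · intro hx
    have hx' : l • (l⁻¹ • (x - a)) + a = x := by
      rw [smul_inv_smul₀ hl.ne', sub_add_cancel]
    exact ⟨l⁻¹ • (x - a), (key _).1 (by rwa [hx']), hx'⟩

/-- Cubes go to cubes. One inequality is enough, because the inverse map has the same form. -/
lemma bmoSeminorm_comp_le (hl : 0 < l) (a : EuclideanSpace ℝ (Fin n))
    (V : Set (EuclideanSpace ℝ (Fin n))) (ψ : EuclideanSpace ℝ (Fin n) → ℝ) :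
    bmoSeminorm V (fun x => ψ (l • x + a)) ≤ bmoSeminorm ((fun y => l • y + a) '' V) ψ := by
  refine iSup_le fun c => iSup_le fun r => iSup_le fun hr => iSup_le fun hc => ?_
  have hm := (isOpen_cube c r).measurableSet
  have himg := image_smul_add_cube hl c a r
  refine le_trans (le_of_eq ?_) (le_iSup_of_le (l • c + a) (le_iSup_of_le (l * r)
    (le_iSup_of_le (mul_pos hl hr) (le_iSup_of_le (himg ▸ Set.image_mono hc) le_rfl))))
  rw [← himg, setAverage_image_smul_add hl hm,
    setLAverage_image_smul_add hl hm (fun x => ‖ψ x - ⨍ x in cube c r, ψ (l • x + a)‖ₑ)]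

lemma MemBMOL1.comp_smul_add (hl : 0 < l) (hV : MeasurableSet V)
    {ψ : EuclideanSpace ℝ (Fin n) → ℝ} (h : MemBMOL1 ((fun y => l • y + a) '' V) ψ) :
    MemBMOL1 V (fun x => ψ (l • x + a)) ∧
      bmoL1Norm V (fun x => ψ (l • x + a)) ≤ bmoL1Norm ((fun y => l • y + a) '' V) ψ := by
  have hle := bmoSeminorm_comp_le hl a V ψ
  have hint := (integrableOn_image_smul_add hl hV ψ).1 h.2
  refine ⟨⟨⟨hint.locallyIntegrableOn, hle.trans_lt h.1.2⟩, hint⟩, ?_⟩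
  unfold bmoL1Norm
  rw [setAverage_image_smul_add hl hV]
  gcongr
  exact h.1.2.ne

/-- `C` bounds the normalized `L^q` norm by the norm of `BMO ∩ L¹`. -/
def IsAverageBound {n : ℕ} (q : ℝ) (U : Set (EuclideanSpace ℝ (Fin n))) (C : ℝ) : Prop :=
  0 < C ∧ ∀ ψ, MemBMOL1 U ψ → (⨍ x in U, |ψ x| ^ q) ^ (1 / q) ≤ C * bmoL1Norm U ψ

/-- `C` is a constant in the interpolation inequality between `BMO ∩ L¹` and `L^p`. -/
def IsInterpolationBound {n : ℕ} (p q : ℝ) (U : Set (EuclideanSpace ℝ (Fin n))) (C : ℝ) : Prop :=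
  0 < C ∧ ∀ ψ, MemBMOL1 U ψ →
    normLp q U ψ ≤ C * bmoL1Norm U ψ ^ (1 - p / q) * normLp p U ψ ^ (p / q)

lemma image_smul_add_image (hl : 0 < l) (a : EuclideanSpace ℝ (Fin n))
    (V : Set (EuclideanSpace ℝ (Fin n))) :
    (fun y => l⁻¹ • y + -(l⁻¹ • a)) '' ((fun y => l • y + a) '' V) = V := by
  rw [Set.image_image]
  simp [smul_smul, hl.ne']

lemma isOpen_image_smul_add (hl : 0 < l) (a : EuclideanSpace ℝ (Fin n)) (hV : IsOpen V) :
    IsOpen ((fun y => l • y + a) '' V) :=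
  ((Homeomorph.smulOfNeZero l hl.ne').trans (Homeomorph.addRight a)).isOpenMap V hV

lemma IsAverageBound.image {q C : ℝ} (hl : 0 < l) (hV : IsOpen V) (h : IsAverageBound q V C) :
    IsAverageBound q ((fun y => l • y + a) '' V) C := by
  refine ⟨h.1, fun ψ hψ => ?_⟩
  obtain ⟨h1, h2⟩ := hψ.comp_smul_add hl hV.measurableSet
  rw [setAverage_image_smul_add hl hV.measurableSet (fun x => |ψ x| ^ q)]
  exact (h.2 _ h1).trans (mul_le_mul_of_nonneg_left h2 h.1.le)

lemma normLp_image_smul_add {q : ℝ} (hl : 0 < l) (hV : IsOpen V)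
    (ψ : EuclideanSpace ℝ (Fin n) → ℝ) :
    normLp q ((fun y => l • y + a) '' V) ψ =
      (l ^ n) ^ (1 / q) * normLp q V fun x => ψ (l • x + a) := by
  unfold normLp
  rw [integral_image_smul_add hl hV.measurableSet (fun x => |ψ x| ^ q),
    Real.mul_rpow (by positivity) (integral_nonneg fun x => by positivity)]

/-- Both sides scale by `l^(n/q)`: on the right it arises as `(l^(n/p))^(p/q)`. -/
lemma IsInterpolationBound.image {p q C : ℝ} (hp : 1 ≤ p) (hpq : p < q) (hl : 0 < l)
    (hV : IsOpen V) (h : IsInterpolationBound p q V C) :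
    IsInterpolationBound p q ((fun y => l • y + a) '' V) C := by
  have hp0 : 0 < p := by linarith
  have hq0 : 0 < q := by linarith
  refine ⟨h.1, fun ψ hψ => ?_⟩
  obtain ⟨h1, h2⟩ := hψ.comp_smul_add hl hV.measurableSet
  have hC := h.1
  have he : 0 ≤ 1 - p / q := sub_nonneg.2 ((div_le_one hq0).2 hpq.le)
  have hP0 : 0 ≤ normLp p V fun x => ψ (l • x + a) :=
    Real.rpow_nonneg (integral_nonneg fun x => by positivity) _
  have hN := bmoL1Norm_nonneg V fun x => ψ (l • x + a)
  have hln : (0 : ℝ) ≤ l ^ n := by positivity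
  have hsplit : normLp p ((fun y => l • y + a) '' V) ψ ^ (p / q) =
      (l ^ n) ^ (1 / q) * (normLp p V fun x => ψ (l • x + a)) ^ (p / q) := by
    rw [normLp_image_smul_add hl hV, Real.mul_rpow (by positivity) hP0, ← Real.rpow_mul hln]
    congr 2
    field_simp
  rw [hsplit, normLp_image_smul_add hl hV]
  calc _ ≤ (l ^ n) ^ (1 / q) * (C * bmoL1Norm V (fun x => ψ (l • x + a)) ^ (1 - p / q) *
          (normLp p V fun x => ψ (l • x + a)) ^ (p / q)) := by
        gcongr
        exact h.2 _ h1
    _ ≤ (l ^ n) ^ (1 / q) * (C * bmoL1Norm ((fun y => l • y + a) '' V) ψ ^ (1 - p / q) *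
          (normLp p V fun x => ψ (l • x + a)) ^ (p / q)) := by
        gcongr
    _ = _ := by ring

lemma isAverageBound_image (q : ℝ) (hl : 0 < l) (a : EuclideanSpace ℝ (Fin n))
    (hV : IsOpen V) :
    IsAverageBound q ((fun y => l • y + a) '' V) = IsAverageBound q V := by
  ext C
  refine ⟨fun h => ?_, fun h => h.image hl hV⟩
  rw [← image_smul_add_image hl a V]
  exact h.image (inv_pos.2 hl) (isOpen_image_smul_add hl a hV)

lemma isInterpolationBound_image {p q : ℝ} (hp : 1 ≤ p) (hpq : p < q) (hl : 0 < l)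
    (a : EuclideanSpace ℝ (Fin n)) (hV : IsOpen V) :
    IsInterpolationBound p q ((fun y => l • y + a) '' V) = IsInterpolationBound p q V := by
  ext C
  refine ⟨fun h => ?_, fun h => h.image hp hpq hl hV⟩
  rw [← image_smul_add_image hl a V]
  exact h.image hp hpq (inv_pos.2 hl) (isOpen_image_smul_add hl a hV)

end Scaling

end BMOInterp

theorem mainTheorem5 (n : ℕ) (hn : 2 ≤ n) :
    ∃ (J₁ : ℝ → Set (EuclideanSpace ℝ (Fin n)) → ℝ)
      (J₂ : ℝ → ℝ → Set (EuclideanSpace ℝ (Fin n)) → ℝ),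
      ∀ U : Set (EuclideanSpace ℝ (Fin n)),
        (BMOInterp.IsLipschitzDomain U ∨ BMOInterp.IsJohnDomain U) →
        (∀ q : ℝ, 1 ≤ q →
          0 < J₁ q U ∧
          ∀ ψ : EuclideanSpace ℝ (Fin n) → ℝ, BMOInterp.MemBMOL1 U ψ →
            MemLp ψ (ENNReal.ofReal q) (volume.restrict U) ∧
            (⨍ x in U, |ψ x| ^ q) ^ (1 / q) ≤ J₁ q U * BMOInterp.bmoL1Norm U ψ) ∧
        (∀ p q : ℝ, 1 ≤ p → p < q →
          0 < J₂ p q U ∧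
          ∀ ψ : EuclideanSpace ℝ (Fin n) → ℝ, BMOInterp.MemBMOL1 U ψ →
            BMOInterp.normLp q U ψ ≤
              J₂ p q U * BMOInterp.bmoL1Norm U ψ ^ (1 - p / q) *
                BMOInterp.normLp p U ψ ^ (p / q)) ∧
        (∀ (l : ℝ) (a : EuclideanSpace ℝ (Fin n)), 0 < l →
          (∀ q : ℝ, 1 ≤ q → J₁ q ((fun x => l • x + a) '' U) = J₁ q U) ∧
          (∀ p q : ℝ, 1 ≤ p → p < q →
            J₂ p q ((fun x => l • x + a) '' U) = J₂ p q U)) := by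
  have : Nonempty (Fin n) := ⟨⟨0, by omega⟩⟩
  -- `Classical.epsilon` sees `U` only through the predicate of admissible constants, so equal
  -- predicates give equal constants for all domains at once.
  refine ⟨fun q U => Classical.epsilon (BMOInterp.IsAverageBound q U),
    fun p q U => Classical.epsilon (BMOInterp.IsInterpolationBound p q U), fun U hU => ?_⟩
  have hopen : IsOpen U := hU.elim (fun h => h.1.1) fun h => h.1.1
  refine ⟨fun q hq => ?_, fun p q hp hpq => ?_, fun l a hl => ⟨fun q _ => ?_, fun p q hp hpq => ?_⟩⟩
  · have h := Classical.epsilon_spec (p := BMOInterp.IsAverageBound q U)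
      (BMOInterp.exists_average_bound hU hq)
    exact ⟨h.1, fun ψ hψ => ⟨BMOInterp.memLp_of_memBMOL1 hU hq hψ, h.2 ψ hψ⟩⟩
  · exact Classical.epsilon_spec (p := BMOInterp.IsInterpolationBound p q U)
      (BMOInterp.exists_interpolation_bound hU hp hpq)
  · exact congrArg Classical.epsilon (BMOInterp.isAverageBound_image q hl a hopen)
  · exact congrArg Classical.epsilon (BMOInterp.isInterpolationBound_image hp hpq hl a hopen)
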